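/- Let $\Phi=\{\pm a,\pm b,\pm(a+b),\pm(2a+b),\pm(3a+b),\pm(3a+2b)\}$ be the root system of type $G_2$ with fundamental roots $a$ (short) and $b$ (long), where $(a,a)=2$, $(a,b)=-3$, $(b,b)=6$. Let $L$ be the complex simple Lie algebra of type $G_2$ with a Chevalley basis $\{h_a,h_b\}\cup\{e_r : r\in\Phi\}$. This means that, with $h_r$ the element of $\mathbb{C}h_a+\mathbb{C}h_b$ given by $(r,r)h_r=m(a,a)h_a+n(b,b)h_b$ for $r=ma+nb\in\Phi$, one has $[h_r,h_s]=0$, $[h_r,e_s]=\frac{2(r,s)}{(r,r)}e_s$, $[e_r,e_{-r}]=h_r$, $[e_r,e_s]=0$ if $0\neq r+s\notin\Phi$, and $[e_r,e_s]=N_{r,s}e_{r+s}$ if $r+s\in\Phi$, where $N_{r,s}=\pm(p+1)$ and $p$ is the largest integer such that $s-ir\in\Phi$ for $0\le i\le p$. Assume that the structure constants of the extraspecial pairs are positive: $N_{a,b}>0$, $N_{a,a+b}>0$, $N_{a,2a+b}>0$, $N_{b,3a+b}>0$. Let $K$ be a commutative ring with identity, let $L_{\mathbb Z}$ be the $\mathbb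 Z$-span of the Chevalley basis and $L_K=K\otimes_{\mathbb Z}L_{\mathbb Z}$. For $r\in\Phi$ and $t\in K$ let $x_r(t)=\exp(t\,\mathrm{ad}\,e_r)=\sum_{i=0}^{3}t^i\otimes\frac{(\mathrm{ad}\,e_r)^i}{i!}$, an element of the Chevalley group of type $G_2$ over $K$, that is, of the group of automorphisms of $L_K$ generated by all these root elements. Write $[g,h]=g^{-1}h^{-1}gh$. Then for all $t,u\in K$: 1. $[x_{b}(u),x_{a}(t)]=x_{a+b}(-tu)\,x_{2a+b}(t^2u)\,x_{3a+b}(-t^3u)\,x_{3a+2b}(-t^3u^2)$ 2. $[x_{a}(u),x_{b}(t)]=x_{a+b}(tu)\,x_{2a+b}(-tu^2)\,x_{3a+b}(tu^3)\,x_{3a+2b}(-2t^2u^3)$ 3. $[x_{a+b}(u),x_{a}(t)]=x_{2a+b}(-2tu)\,x_{3a+b}(3t^2u)\,x_{3a+2b}(-3tu^2)$ 4. $[x_{2a+b}(u),x_{a}(t)]=x_{3a+b}(-3tu)$ 5. $[x_{3a+b}(u),x_{b}(t)]=x_{3a+2b}(-tu)$ 6. $[x_{2a+b}(u),x_{a+b}(t)]=x_{3a+2b}(3tu)$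 7. $[x_{-b}(u),x_{-a}(t)]=x_{-a-b}(tu)\,x_{-2a-b}(t^2u)\,x_{-3a-b}(t^3u)\,x_{-3a-2b}(-t^3u^2)$ 8. $[x_{-a}(u),x_{-b}(t)]=x_{-a-b}(-tu)\,x_{-2a-b}(-tu^2)\,x_{-3a-b}(-tu^3)\,x_{-3a-2b}(-2t^2u^3)$ 9. $[x_{-a-b}(u),x_{-a}(t)]=x_{-2a-b}(2tu)\,x_{-3a-b}(3t^2u)\,x_{-3a-2b}(-3tu^2)$ 10. $[x_{-2a-b}(u),x_{-a}(t)]=x_{-3a-b}(3tu)$ 11. $[x_{-3a-b}(u),x_{-b}(t)]=x_{-3a-2b}(tu)$ 12. $[x_{-2a-b}(u),x_{-a-b}(t)]=x_{-3a-2b}(-3tu)$ 13. $[x_{-a-b}(u),x_{a}(t)]=x_{-b}(3tu)$ 14. $[x_{-2a-b}(u),x_{a}(t)]=x_{-a-b}(2tu)\,x_{-b}(3t^2u)\,x_{-3a-2b}(3tu^2)$ 15. $[x_{-3a-b}(u),x_{a}(t)]=x_{-2a-b}(tu)\,x_{-a-b}(t^2u)\,x_{-b}(t^3u)\,x_{-3a-2b}(t^3u^2)$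 16. $[x_{a}(u),x_{-3a-b}(t)]=x_{-2a-b}(-tu)\,x_{-a-b}(-tu^2)\,x_{-b}(-tu^3)\,x_{-3a-2b}(2t^2u^3)$ 17. $[x_{b}(u),x_{-a-b}(t)]=x_{-a}(tu)\,x_{-2a-b}(-t^2u)\,x_{-3a-2b}(t^3u)\,x_{-3a-b}(-t^3u^2)$ 18. $[x_{-a-b}(u),x_{b}(t)]=x_{-a}(-tu)\,x_{-2a-b}(tu^2)\,x_{-3a-2b}(-tu^3)\,x_{-3a-b}(-2t^2u^3)$ 19. $[x_{-3a-2b}(u),x_{b}(t)]=x_{-3a-b}(tu)$ 20. $[x_{-a}(u),x_{a+b}(t)]=x_{b}(3tu)$ 21. $[x_{-b}(u),x_{a+b}(t)]=x_{a}(-tu)\,x_{2a+b}(-t^2u)\,x_{3a+2b}(-t^3u)\,x_{3a+b}(-t^3u^2)$ 22. $[x_{a+b}(u),x_{-b}(t)]=x_{a}(tu)\,x_{2a+b}(tu^2)\,x_{3a+2b}(tu^3)\,x_{3a+b}(-2t^2u^3)$ 23. $[x_{-2a-b}(u),x_{a+b}(t)]=x_{-a}(-2tu)\,x_{b}(-3t^2u)\,x_{-3a-b}(3tu^2)$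 24. $[x_{-3a-2b}(u),x_{a+b}(t)]=x_{-2a-b}(-tu)\,x_{-a}(t^2u)\,x_{b}(t^3u)\,x_{-3a-b}(t^3u^2)$ 25. $[x_{a+b}(u),x_{-3a-2b}(t)]=x_{-2a-b}(tu)\,x_{-a}(-tu^2)\,x_{b}(-tu^3)\,x_{-3a-b}(2t^2u^3)$ 26. $[x_{-a}(u),x_{2a+b}(t)]=x_{a+b}(2tu)\,x_{3a+2b}(-3t^2u)\,x_{b}(-3tu^2)$ 27. $[x_{-a-b}(u),x_{2a+b}(t)]=x_{a}(-2tu)\,x_{3a+b}(-3t^2u)\,x_{-b}(3tu^2)$ 28. $[x_{-3a-b}(u),x_{2a+b}(t)]=x_{-a}(-tu)\,x_{a+b}(-t^2u)\,x_{3a+2b}(t^3u)\,x_{b}(-t^3u^2)$ 29. $[x_{2a+b}(u),x_{-3a-b}(t)]=x_{-a}(tu)\,x_{a+b}(tu^2)\,x_{3a+2b}(-tu^3)\,x_{b}(-2t^2u^3)$ 30. $[x_{-3a-2b}(u),x_{2a+b}(t)]=x_{-a-b}(tu)\,x_{a}(-t^2u)\,x_{3a+b}(-t^3u)\,x_{-b}(t^3u^2)$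 31. $[x_{2a+b}(u),x_{-3a-2b}(t)]=x_{-a-b}(-tu)\,x_{a}(tu^2)\,x_{3a+b}(tu^3)\,x_{-b}(2t^2u^3)$ 32. $[x_{-a}(u),x_{3a+b}(t)]=x_{2a+b}(tu)\,x_{a+b}(-tu^2)\,x_{b}(tu^3)\,x_{3a+2b}(2t^2u^3)$ 33. $[x_{3a+b}(u),x_{-a}(t)]=x_{2a+b}(-tu)\,x_{a+b}(t^2u)\,x_{b}(-t^3u)\,x_{3a+2b}(t^3u^2)$ 34. $[x_{-2a-b}(u),x_{3a+b}(t)]=x_{a}(-tu)\,x_{-a-b}(tu^2)\,x_{-3a-2b}(tu^3)\,x_{-b}(-2t^2u^3)$ 35. $[x_{3a+b}(u),x_{-2a-b}(t)]=x_{a}(tu)\,x_{-a-b}(-t^2u)\,x_{-3a-2b}(-t^3u)\,x_{-b}(-t^3u^2)$ 36. $[x_{-3a-2b}(u),x_{3a+b}(t)]=x_{-b}(-tu)$ 37. $[x_{-a-b}(u),x_{3a+2b}(t)]=x_{2a+b}(-tu)\,x_{a}(-tu^2)\,x_{-b}(tu^3)\,x_{3a+b}(2t^2u^3)$ 38. $[x_{3a+2b}(u),x_{-a-b}(t)]=x_{2a+b}(tu)\,x_{a}(t^2u)\,x_{-b}(-t^3u)\,x_{3a+b}(t^3u^2)$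 39. $[x_{-2a-b}(u),x_{3a+2b}(t)]=x_{a+b}(tu)\,x_{-a}(tu^2)\,x_{-3a-b}(-tu^3)\,x_{b}(2t^2u^3)$ 40. $[x_{3a+2b}(u),x_{-2a-b}(t)]=x_{a+b}(-tu)\,x_{-a}(-t^2u)\,x_{-3a-b}(t^3u)\,x_{b}(t^3u^2)$ 41. $[x_{-3a-b}(u),x_{3a+2b}(t)]=x_{b}(-tu)$ -/

import Mathlib

open scoped TensorProduct

namespace G2

/-- The root system of type `G₂`, inside its root lattice: the pair `(m, n)` stands for
`m a + n b`, where `a = ε₁ - ε₂` (short) and `b = -2ε₁ + ε₂ + ε₃` (long) are the fundamental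
roots. -/
def roots : Finset (ℤ × ℤ) :=
  {(-3, -2), (-3, -1), (-2, -1), (-1, -1), (-1, 0), (0, -1),
   (1, 0), (0, 1), (1, 1), (2, 1), (3, 1), (3, 2)}

/-- The type of roots. -/
abbrev Root : Type := {r : ℤ × ℤ // r ∈ roots}

/-- The root `m a + n b`. -/
def rt (m n : ℤ) (h : (m, n) ∈ roots := by decide) : Root := ⟨(m, n), h⟩

theorem neg_mem_roots : ∀ r ∈ roots, -r ∈ roots := by decide

instance : Neg Root := ⟨fun r => ⟨-r.1, neg_mem_roots r.1 r.2⟩⟩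

/-- The Euclidean inner product on the root lattice:
`(a, a) = 2`, `(a, b) = -3`, `(b, b) = 6`. -/
def ip (r s : ℤ × ℤ) : ℤ :=
  2 * (r.1 * s.1) - 3 * (r.1 * s.2 + r.2 * s.1) + 6 * (r.2 * s.2)

/-- The Cartan integer `A_{rs} = 2 (r, s) / (r, r)` (the division is exact for roots). -/
def cartanInt (r s : Root) : ℤ := 2 * ip r.1 s.1 / ip r.1 r.1

/-- A Chevalley basis of a complex Lie algebra `L` of type `G₂`: root vectors `e r` for all roots
`r` and coroots `h r`, such that `h a`, `h b` and the `e r` form a basis of `L`, with the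
multiplication rules of a Chevalley basis and integral structure constants `N r s`. -/
structure ChevalleyBasis (L : Type*) [LieRing L] [LieAlgebra ℂ L] where
  /-- The coroots. -/
  h : Root → L
  /-- The root vectors. -/
  e : Root → L
  /-- The structure constants `N_{r,s}` (meaningful when `r + s` is a root). -/
  N : Root → Root → ℤ
  linearIndependent : LinearIndependent ℂ (Sum.elim ![h (rt 1 0), h (rt 0 1)] e)
  span_eq_top : Submodule.span ℂ (Set.range (Sum.elim ![h (rt 1 0), h (rt 0 1)] e)) = ⊤
  /-- `h r` corresponds to `2 r / (r, r)`: for `r = m a + n b` one has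
  `(r, r) h_r = m (a, a) h_a + n (b, b) h_b`. -/
  ip_smul_h : ∀ r : Root, ip r.1 r.1 • h r =
    (r.1.1 * ip (1, 0) (1, 0)) • h (rt 1 0) + (r.1.2 * ip (0, 1) (0, 1)) • h (rt 0 1)
  lie_h_h : ∀ r s : Root, ⁅h r, h s⁆ = 0
  lie_h_e : ∀ r s : Root, ⁅h r, e s⁆ = cartanInt r s • e s
  lie_e_neg : ∀ r : Root, ⁅e r, e (-r)⁆ = h r
  lie_e_e_eq_zero : ∀ r s : Root, r.1 + s.1 ≠ 0 → r.1 + s.1 ∉ roots → ⁅e r, e s⁆ = 0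
  lie_e_e : ∀ r s q : Root, r.1 + s.1 = q.1 → ⁅e r, e s⁆ = N r s • e q
  /-- `N_{r,s} = ±(p + 1)`, where `s - p r, …, s` is the descending part of the `r`-string
  through `s`. -/
  N_eq : ∀ r s : Root, r.1 + s.1 ∈ roots → ∀ p : ℕ, (∀ i : ℕ, i ≤ p → s.1 - i • r.1 ∈ roots) →
    s.1 - (p + 1) • r.1 ∉ roots → N r s = p + 1 ∨ N r s = -(p + 1)

/-- The number `p` such that `s - p r, …, s` is the descending part of the `r`-string. -/
def strLen (r s : Root) : ℕ := Nat.findGreatest (fun p => s.1 - p • r.1 ∈ roots) 3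

theorem strLen_le (r s : Root) : strLen r s ≤ 3 := Nat.findGreatest_le 3

theorem string_step : ∀ r s : Root, s ≠ r → s ≠ -r →
    r.1 + s.1 ≠ 0 ∧ (∀ i : ℕ, i ≤ strLen r s → s.1 - i • r.1 ∈ roots) ∧
    s.1 - (strLen r s + 1) • r.1 ∉ roots ∧
    ∀ q : Root, r.1 + s.1 = q.1 → q ≠ r ∧ q ≠ -r ∧ strLen r q = strLen r s + 1 := by
  decide +kernel

theorem coroot_coeff : ∀ r : Root, ip r.1 r.1 ≠ 0 ∧
    ip r.1 r.1 * (r.1.1 * ip (1, 0) (1, 0) / ip r.1 r.1) = r.1.1 * ip (1, 0) (1, 0) ∧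
    ip r.1 r.1 * (r.1.2 * ip (0, 1) (0, 1) / ip r.1 r.1) = r.1.2 * ip (0, 1) (0, 1) := by
  decide +kernel

theorem cartanInt_self : ∀ r : Root, cartanInt r r = 2 := by decide +kernel

namespace ChevalleyBasis

noncomputable section

variable {L : Type*} [LieRing L] [LieAlgebra ℂ L] (C : ChevalleyBasis L)

/-- The integral form `L_ℤ` of `L`: the `ℤ`-span of the Chevalley basis. -/
def lattice : Submodule ℤ L :=
  Submodule.span ℤ (Set.range (Sum.elim ![C.h (rt 1 0), C.h (rt 0 1)] C.e))

/-- The divided power `(ad e_r)^i / i!` on `L`. -/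
def divPow (r : Root) (i : ℕ) : Module.End ℂ L :=
  (i.factorial : ℂ)⁻¹ • (LieAlgebra.ad ℂ L (C.e r)) ^ i

theorem e_mem (r : Root) : C.e r ∈ C.lattice := Submodule.subset_span ⟨Sum.inr r, rfl⟩

theorem h_mem (r : Root) : C.h r ∈ C.lattice := by
  have ha : C.h (rt 1 0) ∈ C.lattice := Submodule.subset_span ⟨Sum.inl 0, rfl⟩
  have hb : C.h (rt 0 1) ∈ C.lattice := Submodule.subset_span ⟨Sum.inl 1, rfl⟩
  obtain ⟨h0, h1, h2⟩ := coroot_coeff r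
  have key : C.h r = (r.1.1 * ip (1, 0) (1, 0) / ip r.1 r.1) • C.h (rt 1 0) +
      (r.1.2 * ip (0, 1) (0, 1) / ip r.1 r.1) • C.h (rt 0 1) := by
    have h3 := C.ip_smul_h r
    rw [← h1, ← h2, mul_smul, mul_smul, ← smul_add] at h3
    have h4 : ((ip r.1 r.1 : ℤ) : ℂ) ≠ 0 := by exact_mod_cast h0
    rw [← Int.cast_smul_eq_zsmul ℂ, ← Int.cast_smul_eq_zsmul ℂ] at h3
    exact smul_right_injective L h4 h3
  rw [key]
  exact add_mem (Submodule.smul_mem _ _ ha) (Submodule.smul_mem _ _ hb)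

theorem divPow_zero (r : Root) : C.divPow r 0 = 1 := by simp [divPow]

theorem divPow_succ (r : Root) (i : ℕ) (v : L) :
    C.divPow r (i + 1) v = ((i : ℂ) + 1)⁻¹ • ⁅C.e r, C.divPow r i v⁆ := by
  simp only [divPow, LinearMap.smul_apply, pow_succ', Module.End.mul_apply, LieAlgebra.ad_apply,
    lie_smul, smul_smul, Nat.factorial_succ, Nat.cast_mul, Nat.cast_add, Nat.cast_one, mul_inv]

theorem divPow_mul (r : Root) (i j : ℕ) :
    C.divPow r i * C.divPow r j = ((i + j).choose i : ℂ) • C.divPow r (i + j) := by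
  simp only [divPow, smul_mul_smul_comm, ← pow_add, smul_smul]
  congr 1
  rw [Nat.cast_add_choose]
  have hi : ((i + j).factorial : ℂ) ≠ 0 := by exact_mod_cast (i + j).factorial_ne_zero
  field_simp

/-- Divided powers on the part of the basis off the line through `r`. -/
theorem divPow_e (r s : Root) (h1 : s ≠ r) (h2 : s ≠ -r) (i : ℕ) :
    C.divPow r i (C.e s) = 0 ∨ ∃ q : Root, q ≠ r ∧ q ≠ -r ∧ strLen r q = strLen r s + i ∧
      ∃ n : ℤ, (n = (strLen r s + i).choose i ∨ n = -((strLen r s + i).choose i : ℤ)) ∧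
        C.divPow r i (C.e s) = n • C.e q := by
  induction i with
  | zero => exact Or.inr ⟨s, h1, h2, rfl, 1, by simp, by simp [divPow_zero]⟩
  | succ i ih =>
    rcases ih with h | ⟨q, hq1, hq2, hq3, n, hn, hv⟩
    · left; rw [divPow_succ, h, lie_zero, smul_zero]
    · obtain ⟨g1, g2, g3, g4⟩ := string_step r q hq1 hq2
      by_cases hr : r.1 + q.1 ∈ roots
      · right
        obtain ⟨k1, k2, k3⟩ := g4 ⟨_, hr⟩ rfl
        refine ⟨⟨_, hr⟩, k1, k2, by omega, ?_⟩
        have hN := C.N_eq r q hr _ g2 g3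
        rw [hq3] at hN
        have hc := Nat.add_one_mul_choose_eq (strLen r s + i) i
        rw [divPow_succ, hv, lie_zsmul, C.lie_e_e r q ⟨_, hr⟩ rfl]
        have hi : ((i : ℂ) + 1) ≠ 0 := by exact_mod_cast i.succ_ne_zero
        have main : ∀ m : ℤ, n * C.N r q = (i + 1) * m →
            ((i : ℂ) + 1)⁻¹ • n • C.N r q • C.e ⟨_, hr⟩ = m • C.e ⟨_, hr⟩ := by
          intro m hm
          rw [smul_smul n, hm, mul_smul, ← Int.cast_smul_eq_zsmul ℂ (((i : ℤ) + 1)), smul_smul]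
          push_cast
          rw [inv_mul_cancel₀ hi, one_smul]
        have hc' : ((strLen r s : ℤ) + i + 1) * ((strLen r s + i).choose i : ℤ) =
            ((strLen r s + (i + 1)).choose (i + 1) : ℤ) * (i + 1) := by
          exact_mod_cast hc
        push_cast at hN
        rcases hn with hn | hn <;> rcases hN with hN | hN
        · exact ⟨_, Or.inl rfl, main _ (by rw [hn, hN]; linear_combination hc')⟩
        · exact ⟨_, Or.inr rfl, main _ (by rw [hn, hN]; linear_combination -hc')⟩
        · exact ⟨_, Or.inr rfl, main _ (by rw [hn, hN]; linear_combination -hc')⟩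
        · exact ⟨_, Or.inl rfl, main _ (by rw [hn, hN]; linear_combination hc')⟩
      · left
        rw [divPow_succ, hv, lie_zsmul, C.lie_e_e_eq_zero r q g1 hr, smul_zero, smul_zero]

theorem divPow_eq_zero_of_le (r : Root) (v : L) {i j : ℕ} (hij : i ≤ j)
    (h : C.divPow r i v = 0) : C.divPow r j v = 0 := by
  induction j, hij using Nat.le_induction with
  | base => exact h
  | succ j _ ih => rw [divPow_succ, ih, lie_zero, smul_zero]

theorem divPow_h (r s : Root) :
    C.divPow r 1 (C.h s) ∈ C.lattice ∧ C.divPow r 2 (C.h s) = 0 := by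
  have h1 : C.divPow r 1 (C.h s) = -(cartanInt s r • C.e r) := by
    rw [divPow_succ, divPow_zero, Module.End.one_apply, ← lie_skew, C.lie_h_e]; simp
  refine ⟨?_, ?_⟩
  · rw [h1]; exact neg_mem (Submodule.smul_mem _ _ (C.e_mem r))
  · rw [divPow_succ, h1]; simp

theorem divPow_neg (r : Root) : C.divPow r 1 (C.e (-r)) ∈ C.lattice ∧
    C.divPow r 2 (C.e (-r)) ∈ C.lattice ∧ C.divPow r 3 (C.e (-r)) = 0 := by
  have h1 : C.divPow r 1 (C.e (-r)) = C.h r := by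
    rw [divPow_succ, divPow_zero, Module.End.one_apply, C.lie_e_neg]; simp
  have h2 : C.divPow r 2 (C.e (-r)) = -C.e r := by
    rw [divPow_succ, h1, ← lie_skew, C.lie_h_e, cartanInt_self,
      ← Int.cast_smul_eq_zsmul ℂ, smul_neg, smul_smul]
    norm_num
  refine ⟨h1 ▸ C.h_mem r, h2 ▸ neg_mem (C.e_mem r), ?_⟩
  rw [divPow_succ, h2]; simp

theorem divPow_gen (r : Root) (g : Fin 2 ⊕ Root) :
    (∀ i, C.divPow r i (Sum.elim ![C.h (rt 1 0), C.h (rt 0 1)] C.e g) ∈ C.lattice) ∧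
      C.divPow r 4 (Sum.elim ![C.h (rt 1 0), C.h (rt 0 1)] C.e g) = 0 := by
  have hh : ∀ s, (∀ i, C.divPow r i (C.h s) ∈ C.lattice) ∧ C.divPow r 4 (C.h s) = 0 := by
    intro s
    obtain ⟨k1, k2⟩ := C.divPow_h r s
    refine ⟨fun i => ?_, C.divPow_eq_zero_of_le r _ (by norm_num) k2⟩
    match i with
    | 0 => simpa [divPow_zero] using C.h_mem s
    | 1 => exact k1
    | i + 2 => rw [C.divPow_eq_zero_of_le r _ (by omega) k2]; exact zero_mem _
  rcases g with g | s
  · fin_cases g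
    · exact hh _
    · exact hh _
  · change (∀ i, C.divPow r i (C.e s) ∈ C.lattice) ∧ C.divPow r 4 (C.e s) = 0
    by_cases h1 : s = r
    · subst h1
      have k : C.divPow s 1 (C.e s) = 0 := by
        rw [divPow_succ, divPow_zero, Module.End.one_apply, lie_self, smul_zero]
      refine ⟨fun i => ?_, C.divPow_eq_zero_of_le s _ (by norm_num) k⟩
      match i with
      | 0 => simpa [divPow_zero] using C.e_mem s
      | i + 1 => rw [C.divPow_eq_zero_of_le s _ (by omega) k]; exact zero_mem _
    · by_cases h2 : s = -r
      · subst h2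
        obtain ⟨k1, k2, k3⟩ := C.divPow_neg r
        refine ⟨fun i => ?_, C.divPow_eq_zero_of_le r _ (by norm_num) k3⟩
        match i with
        | 0 => simpa [divPow_zero] using C.e_mem (-r)
        | 1 => exact k1
        | 2 => exact k2
        | i + 3 => rw [C.divPow_eq_zero_of_le r _ (by omega) k3]; exact zero_mem _
      · refine ⟨fun i => ?_, ?_⟩
        · rcases C.divPow_e r s h1 h2 i with h | ⟨q, -, -, -, n, -, h⟩
          · rw [h]; exact zero_mem _
          · rw [h]; exact Submodule.smul_mem _ _ (C.e_mem q)
        · rcases C.divPow_e r s h1 h2 4 with h | ⟨q, -, -, h, -⟩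
          · exact h
          · have := strLen_le r q; omega

theorem divPow_mem (r : Root) (i : ℕ) :
    ∀ v ∈ C.lattice, (C.divPow r i).restrictScalars ℤ v ∈ C.lattice := by
  intro v hv
  have : C.lattice ≤ C.lattice.comap ((C.divPow r i).restrictScalars ℤ) := by
    conv_lhs => rw [lattice]
    rw [Submodule.span_le]
    rintro _ ⟨g, rfl⟩
    exact (C.divPow_gen r g).1 i
  exact this hv

theorem divPow_four (r : Root) : C.divPow r 4 = 0 := by
  refine LinearMap.ext_on_range C.span_eq_top fun g => ?_
  exact (C.divPow_gen r g).2

/-- The divided power `(ad e_r)^i / i!` on the integral form `L_ℤ`. -/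
def intDivPow (r : Root) (i : ℕ) : Module.End ℤ C.lattice :=
  ((C.divPow r i).restrictScalars ℤ).restrict (C.divPow_mem r i)

theorem intDivPow_zero (r : Root) : C.intDivPow r 0 = 1 := by
  ext v; simp [intDivPow, divPow_zero]

theorem intDivPow_of_le (r : Root) (i : ℕ) (hi : 4 ≤ i) : C.intDivPow r i = 0 := by
  ext v
  simp [intDivPow, C.divPow_eq_zero_of_le r v hi (by simp [divPow_four])]

theorem intDivPow_mul (r : Root) (i j : ℕ) :
    C.intDivPow r i * C.intDivPow r j = (i + j).choose i • C.intDivPow r (i + j) := by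
  ext v
  have := LinearMap.congr_fun (C.divPow_mul r i j) (v : L)
  rw [LinearMap.smul_apply, Nat.cast_smul_eq_nsmul] at this
  simpa [intDivPow] using this

variable (K : Type*) [CommRing K]

/-- The Lie algebra (as a module) `L_K = K ⊗ L_ℤ` over `K`. -/
abbrev Form : Type _ := K ⊗[ℤ] C.lattice

variable {K}

/-- The endomorphism `exp (t ad e_r) = ∑ tⁱ (ad e_r)ⁱ / i!` of `L_K`
(`(ad e_r)⁴ = 0`, so that the sum stops at `i = 3`). -/
def rootEnd (r : Root) (t : K) : Module.End K (C.Form K) :=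
  ∑ i ∈ Finset.range 4, t ^ i • (C.intDivPow r i).baseChange K

theorem rootEnd_zero (r : Root) : C.rootEnd r (0 : K) = 1 := by
  simp [rootEnd, Finset.sum_range_succ, intDivPow_zero, Module.End.one_eq_id]

theorem rootEnd_mul (r : Root) (t u : K) :
    C.rootEnd r t * C.rootEnd r u = C.rootEnd r (t + u) := by
  have key : ∀ i j : ℕ, (C.intDivPow r i).baseChange K * (C.intDivPow r j).baseChange K =
      ((i + j).choose i : K) • (C.intDivPow r (i + j)).baseChange K := by
    intro i j
    have h : (C.intDivPow r i * C.intDivPow r j).baseChange K =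
        (C.intDivPow r i).baseChange K * (C.intDivPow r j).baseChange K :=
      LinearMap.baseChange_comp ..
    rw [← h, intDivPow_mul]
    ext v
    simp [TensorProduct.smul_tmul', TensorProduct.tmul_smul, Nat.cast_smul_eq_nsmul]
  have h0 : ∀ i, 4 ≤ i → (C.intDivPow r i).baseChange K = 0 := by
    intro i hi
    rw [C.intDivPow_of_le r i hi, LinearMap.baseChange_zero]
  simp only [rootEnd, Finset.sum_range_succ, Finset.sum_range_zero, zero_add, add_mul, mul_add,
    smul_mul_smul_comm, key, h0 4 (by norm_num), h0 5 (by norm_num), h0 6 (by norm_num),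
    Nat.reduceAdd, smul_zero, add_zero, smul_smul]
  norm_num [Nat.choose]
  module

/-- The root element `x_r(t) = exp (t ad e_r)` as an automorphism of `L_K`. -/
def rootAut (r : Root) (t : K) : C.Form K ≃ₗ[K] C.Form K :=
  LinearEquiv.ofLinearMap (C.rootEnd r t) (C.rootEnd r (-t))
    (by rw [← Module.End.mul_eq_comp, rootEnd_mul, add_neg_cancel, rootEnd_zero]; rfl)
    (by rw [← Module.End.mul_eq_comp, rootEnd_mul, neg_add_cancel, rootEnd_zero]; rfl)

variable (K) in
/-- The Chevalley group of type `G₂` over `K`: the group of automorphisms of `L_K` generated by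
all root elements. -/
def chevalleyGroup : Subgroup (C.Form K ≃ₗ[K] C.Form K) :=
  Subgroup.closure {g | ∃ (r : Root) (t : K), g = C.rootAut r t}

/-- The root element `x_r(t)` of the Chevalley group, for the root `r = m a + n b`. -/
def x (m n : ℤ) (t : K) (h : (m, n) ∈ roots := by decide) : C.chevalleyGroup K :=
  ⟨C.rootAut (rt m n h) t, Subgroup.subset_closure ⟨rt m n h, t, rfl⟩⟩

end

end ChevalleyBasis

/-- The commutator `[g, h] = g⁻¹ h⁻¹ g h`. -/
def comm {G : Type*} [Group G] (g h : G) : G := g⁻¹ * h⁻¹ * g * h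

end G2

open G2

/-! The four extraspecial signs determine every structure constant, so the adjoint action of every
root element is explicit and each commutator relation becomes a finite polynomial computation.

Signs: the size of `N_{r,s}` is prescribed, and only its sign is open. Three consequences of the Lie
axioms spread positivity. For `r + s + q = 0`, Jacobi gives `N_{r,s} h_q + N_{s,q} h_r + N_{q,r} h_s
= 0`, so the sign is invariant under cyclic rotation (`N_pos_rotate`). Jacobi for `e_r, e_{-r}, e_s`
compares `N_{r,s}` with `N_{-r,r+s}` (`N_pos_opposite`); with rotation this gives invariance under
`(r, s) ↦ (-s, -r)`. Jacobi for `a, b, 2a+b` settles the one remaining orbit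
(`IsExtraspecialPos.two_one`). Antisymmetry gives the negative constants, whence
`IsExtraspecialPos.N_eq_structConst`.

Relations: the divided powers of `ad e_r` have integer matrices on the Chevalley basis. Hence both
sides of `x_r(u) x_s(t) = x_s(t) x_r(u) w` send a basis vector to a combination of basis vectors
with coefficients in `ℤ[t, u]`. Comparing these for the 14 basis vectors proves the relation over
every `K` at once, since the basis spans `L_K` (`IsExtraspecialPos.comm_rootElt`). -/

namespace G2

/-! ### Sign pattern of the structure constants: finite checks in the root system -/

/-- Pairs of roots which, up to cyclic rotation of `(r, s, -(r + s))` and the symmetry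
`(r, s) ↦ (-s, -r)`, represent all pairs with a positive structure constant. -/
def positivePairs : List ((ℤ × ℤ) × (ℤ × ℤ)) :=
  [((1, 0), (0, 1)), ((1, 0), (1, 1)), ((1, 0), (2, 1)), ((0, 1), (3, 1)), ((2, 1), (1, 1))]

/-- The pairs of roots with a positive structure constant. -/
def IsPositive (r s : ℤ × ℤ) : Prop :=
  (r, s) ∈ positivePairs ∨ (s, -(r + s)) ∈ positivePairs ∨ (-(r + s), r) ∈ positivePairs ∨
    (-s, -r) ∈ positivePairs ∨ (r + s, -s) ∈ positivePairs ∨ (-r, r + s) ∈ positivePairs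

instance (r s : ℤ × ℤ) : Decidable (IsPositive r s) := by unfold IsPositive; infer_instance

/-- The structure constant `N_{r,s}` of the Chevalley basis with positive extraspecial pairs. -/
def structConst (r s : Root) : ℤ :=
  if IsPositive r.1 s.1 then strLen r s + 1 else -(strLen r s + 1)

/-- The coefficient of `h_a` in `h_r`. -/
def corootA (r : Root) : ℤ := r.1.1 * ip (1, 0) (1, 0) / ip r.1 r.1

/-- The coefficient of `h_b` in `h_r`. -/
def corootB (r : Root) : ℤ := r.1.2 * ip (0, 1) (0, 1) / ip r.1 r.1

theorem ne_of_add_mem_roots : ∀ r s : Root, r.1 + s.1 ∈ roots → s ≠ r ∧ s ≠ -r := by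
  decide +kernel

/-- Coroots are positive multiples of roots and any two of `r, s, q` are independent, so the linear
relations between the three coroots are the multiples of one with positive coefficients. The signs
must therefore agree. -/
theorem sign_eq_of_coroot_relation : ∀ r s q : Root, r.1 + s.1 + q.1 = 0 →
    ∀ i ∈ [(1 : ℤ), -1], ∀ j ∈ [(1 : ℤ), -1], ∀ k ∈ [(1 : ℤ), -1],
    i * (strLen r s + 1) * corootA q + j * (strLen s q + 1) * corootA r +
      k * (strLen q r + 1) * corootA s = 0 →
    i * (strLen r s + 1) * corootB q + j * (strLen s q + 1) * corootB r +
      k * (strLen q r + 1) * corootB s = 0 → i = j := by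
  decide +kernel

/-- If the `r`-string through `s` has `p` steps below `s` and `q ≥ 1` above, the Cartan integer is
`p - q` and the two products are `p(q+1)` and `(p+1)q`. A wrong sign `i = -1` would force `p = q`,
but strings off the line of `r` in `G₂` have 1, 2 or 4 members. -/
theorem sign_eq_one_of_string_relation : ∀ r s p : Root, r.1 + s.1 = p.1 →
    (s.1 - r.1 ∉ roots → ∀ i ∈ [(1 : ℤ), -1],
      cartanInt r s = -(i * (strLen r s + 1) * (strLen (-r) p + 1)) → i = 1) ∧
    (∀ h : s.1 - r.1 ∈ roots, ∀ i ∈ [(1 : ℤ), -1], ∀ j ∈ [(1 : ℤ), -1],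
      cartanInt r s = j * (strLen (-r) s + 1) * (strLen r ⟨s.1 - r.1, h⟩ + 1) -
        i * (strLen r s + 1) * (strLen (-r) p + 1) → i = 1) := by
  decide +kernel

/-- The five listed orbits, together with their swaps, exhaust all pairs whose sum is a root; this
makes the sign rule complete. -/
theorem isPositive_or_swap : ∀ r s : Root, r.1 + s.1 ∈ roots →
    IsPositive r.1 s.1 ∨ IsPositive s.1 r.1 ∧ ¬ IsPositive r.1 s.1 := by
  decide +kernel

theorem strLen_comm_of_add_mem : ∀ r s : Root, r.1 + s.1 ∈ roots → strLen s r = strLen r s := by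
  decide +kernel

/-! ### Signs forced by the Jacobi identity -/

namespace ChevalleyBasis

variable {L : Type*} [LieRing L] [LieAlgebra ℂ L] (C : ChevalleyBasis L)

theorem h_eq (r : Root) : C.h r = corootA r • C.h (rt 1 0) + corootB r • C.h (rt 0 1) := by
  obtain ⟨h0, h1, h2⟩ := coroot_coeff r
  have h3 := C.ip_smul_h r
  rw [← h1, ← h2, mul_smul, mul_smul, ← smul_add] at h3
  have h4 : ((ip r.1 r.1 : ℤ) : ℂ) ≠ 0 := by exact_mod_cast h0
  rw [← Int.cast_smul_eq_zsmul ℂ, ← Int.cast_smul_eq_zsmul ℂ] at h3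
  exact smul_right_injective L h4 h3

theorem e_ne_zero (r : Root) : C.e r ≠ 0 := C.linearIndependent.ne_zero (Sum.inr r)

theorem zsmul_e_injective (r : Root) {m n : ℤ} (h : m • C.e r = n • C.e r) : m = n := by
  rw [← Int.cast_smul_eq_zsmul ℂ, ← Int.cast_smul_eq_zsmul ℂ] at h
  exact_mod_cast smul_left_injective ℂ (C.e_ne_zero r) h

theorem eq_zero_of_smul_h_add_smul_h {m n : ℤ}
    (h : m • C.h (rt 1 0) + n • C.h (rt 0 1) = 0) : m = 0 ∧ n = 0 := by
  have hl := C.linearIndependent.comp Sum.inl Sum.inl_injective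
  rw [Sum.elim_comp_inl, LinearIndependent.pair_iff] at hl
  have := hl m n (by simpa only [Int.cast_smul_eq_zsmul] using h)
  exact_mod_cast this

theorem exists_sign (r s : Root) (h : r.1 + s.1 ∈ roots) :
    ∃ i ∈ [(1 : ℤ), -1], C.N r s = i * (strLen r s + 1) := by
  obtain ⟨h1, h2⟩ := ne_of_add_mem_roots r s h
  obtain ⟨-, h3, h4, -⟩ := string_step r s h1 h2
  rcases C.N_eq r s h _ h3 h4 with h | h
  · exact ⟨1, by simp, by rw [h]; ring⟩
  · exact ⟨-1, by simp, by rw [h]; ring⟩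

theorem N_swap (r s : Root) (h : r.1 + s.1 ∈ roots) : C.N s r = -C.N r s := by
  refine C.zsmul_e_injective ⟨_, h⟩ ?_
  rw [← C.lie_e_e s r ⟨_, h⟩ (add_comm _ _), neg_smul, ← C.lie_e_e r s ⟨_, h⟩ rfl, lie_skew]

theorem lie_e_lie_e_e {r s q : Root} (h : r.1 + s.1 + q.1 = 0) :
    ⁅C.e q, ⁅C.e r, C.e s⁆⁆ = C.N r s • C.h q := by
  rw [C.lie_e_e r s (-q) (eq_neg_of_add_eq_zero_left h), lie_zsmul, C.lie_e_neg]

theorem add_mem_of_add_eq_zero {r s q : Root} (h : r.1 + s.1 + q.1 = 0) :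
    r.1 + s.1 ∈ roots := by
  rw [eq_neg_of_add_eq_zero_left h]; exact (-q).2

/-- Each double bracket in the Jacobi identity for `e_q, e_r, e_s` is a multiple of a coroot.
Comparing coefficients at the independent `h_a`, `h_b` gives the relation that fixes the signs. -/
theorem N_pos_rotate {r s q : Root} (h : r.1 + s.1 + q.1 = 0) (hp : 0 < C.N r s) :
    0 < C.N s q := by
  have h2 : s.1 + q.1 + r.1 = 0 := by rw [← h]; abel
  have h3 : q.1 + r.1 + s.1 = 0 := by rw [← h]; abel
  obtain ⟨i, hi, hi'⟩ := C.exists_sign r s (add_mem_of_add_eq_zero h)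
  obtain ⟨j, hj, hj'⟩ := C.exists_sign s q (add_mem_of_add_eq_zero h2)
  obtain ⟨k, hk, hk'⟩ := C.exists_sign q r (add_mem_of_add_eq_zero h3)
  have hJ := lie_jacobi (C.e q) (C.e r) (C.e s)
  rw [C.lie_e_lie_e_e h, C.lie_e_lie_e_e h2, C.lie_e_lie_e_e h3, C.h_eq q, C.h_eq r,
    C.h_eq s] at hJ
  obtain ⟨hA, hB⟩ := C.eq_zero_of_smul_h_add_smul_h
    (m := C.N r s * corootA q + C.N s q * corootA r + C.N q r * corootA s)
    (n := C.N r s * corootB q + C.N s q * corootB r + C.N q r * corootB s)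
    (by rw [← hJ]; module)
  rw [hi', hj', hk'] at hA hB
  have hij := sign_eq_of_coroot_relation r s q h i hi j hj k hk hA hB
  rw [hi'] at hp
  rw [hj', ← hij]
  -- The common sign is positive because the string factor is.
  have := pos_of_mul_pos_left hp (by positivity)
  positivity

theorem lie_e_lie_neg {r s p : Root} (h : r.1 + s.1 = p.1) :
    ⁅C.e (-r), ⁅C.e r, C.e s⁆⁆ = (C.N r s * C.N (-r) p) • C.e s := by
  rw [C.lie_e_e r s p h, lie_zsmul, C.lie_e_e (-r) p s, smul_smul]
  rw [← h]; exact neg_add_cancel_left _ _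

/-- Evaluating `⁅⁅e_r, e_{-r}⁆, e_s⁆` in two ways expresses the Cartan integer as `N_{-r,s}
N_{r,s-r} - N_{r,s} N_{-r,r+s}`, with the first product absent when `s - r` is not a root. -/
theorem N_pos_opposite {r s p : Root} (h : r.1 + s.1 = p.1) (hp : 0 < C.N r s) :
    0 < C.N (-r) p := by
  have hrs : r.1 + s.1 ∈ roots := h ▸ p.2
  have hps : (-r).1 + p.1 = s.1 := by rw [← h]; exact neg_add_cancel_left _ _
  obtain ⟨i, hi, hi'⟩ := C.exists_sign r s hrs
  obtain ⟨i', hi1, hi2⟩ := C.exists_sign (-r) p (hps ▸ s.2)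
  obtain ⟨k1, k2⟩ := sign_eq_one_of_string_relation r s p h
  have mul_mem : ∀ i ∈ [(1 : ℤ), -1], ∀ j ∈ [(1 : ℤ), -1], i * j ∈ [(1 : ℤ), -1] := by decide
  have hJ := lie_lie (C.e r) (C.e (-r)) (C.e s)
  rw [C.lie_e_neg, C.lie_h_e, C.lie_e_lie_neg h] at hJ
  -- Only the products of signs enter the relation, so the numerical check is applied to `i * i'`
  -- and `j * j'`.
  have hii : i * i' = 1 := by
    by_cases hm : s.1 - r.1 ∈ roots
    · set q : Root := ⟨s.1 - r.1, hm⟩ with hq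
      have hq1 : (-r).1 + s.1 = q.1 := (sub_eq_neg_add s.1 r.1).symm
      have hq2 : r.1 + q.1 = s.1 := add_sub_cancel _ _
      obtain ⟨j, hj, hj'⟩ := C.exists_sign (-r) s (hq1 ▸ q.2)
      obtain ⟨j', hj1, hj2⟩ := C.exists_sign r q (hq2 ▸ s.2)
      rw [C.lie_e_e _ _ q hq1, lie_zsmul, C.lie_e_e _ _ s hq2, smul_smul, ← sub_smul] at hJ
      have hN := C.zsmul_e_injective s hJ
      refine k2 hm _ (mul_mem _ hi _ hi1) _ (mul_mem _ hj _ hj1) ?_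
      rw [hN, hi', hi2, hj', hj2]; ring
    · have hne : (-r).1 + s.1 ≠ 0 := fun h0 =>
        (ne_of_add_mem_roots r s hrs).1 (Subtype.ext (neg_add_eq_zero.mp h0).symm)
      have hm' : (-r).1 + s.1 ∉ roots := fun h0 => hm (sub_eq_neg_add s.1 r.1 ▸ h0)
      rw [C.lie_e_e_eq_zero _ _ hne hm', lie_zero, zero_sub, ← neg_smul] at hJ
      have hN := C.zsmul_e_injective s hJ
      refine k1 hm _ (mul_mem _ hi _ hi1) ?_
      rw [hN, hi', hi2]; ring
  rw [hi'] at hp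
  have hi0 := pos_of_mul_pos_left hp (by positivity)
  have hi3 : 0 < i' := pos_of_mul_pos_right (hii ▸ one_pos) hi0.le
  rw [hi2]
  positivity

/-- With `p = r + s`, the pair `(-r, p)` is positive by `N_pos_opposite`, and two rotations of `(-r,
p, -s)` lead to `(-s, -r)`. -/
theorem N_pos_neg_swap {r s : Root} (h : r.1 + s.1 ∈ roots) (hp : 0 < C.N r s) :
    0 < C.N (-s) (-r) := by
  set p : Root := ⟨_, h⟩
  have h1 : (-r).1 + p.1 + (-s).1 = 0 := by
    change -r.1 + (r.1 + s.1) + -s.1 = 0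
    abel
  have h2 : p.1 + (-s).1 + (-r).1 = 0 := by rw [← h1]; abel
  exact C.N_pos_rotate h2 (C.N_pos_rotate h1 (C.N_pos_opposite (p := p) rfl hp))

/-- The Chevalley basis has positive structure constants at the extraspecial pairs. -/
structure IsExtraspecialPos : Prop where
  a_b : 0 < C.N (rt 1 0) (rt 0 1)
  a_ab : 0 < C.N (rt 1 0) (rt 1 1)
  a_2ab : 0 < C.N (rt 1 0) (rt 2 1)
  b_3ab : 0 < C.N (rt 0 1) (rt 3 1)

variable {C}

/-- Since `2a + 2b` is not a root, Jacobi for `a, b, 2a+b` reduces to `N_{a,b} N_{2a+b,a+b} =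
N_{a,2a+b} N_{b,3a+b}`. -/
theorem IsExtraspecialPos.two_one (hC : C.IsExtraspecialPos) :
    0 < C.N (rt 2 1) (rt 1 1) := by
  have hJ := lie_jacobi (C.e (rt 1 0)) (C.e (rt 0 1)) (C.e (rt 2 1))
  rw [C.lie_e_e_eq_zero (rt 0 1) (rt 2 1) (by decide) (by decide), lie_zero, zero_add,
    C.lie_e_e (rt 2 1) (rt 1 0) (rt 3 1) (by decide),
    C.lie_e_e (rt 1 0) (rt 0 1) (rt 1 1) (by decide), lie_zsmul, lie_zsmul,
    C.lie_e_e (rt 0 1) (rt 3 1) (rt 3 2) (by decide),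
    C.lie_e_e (rt 2 1) (rt 1 1) (rt 3 2) (by decide), smul_smul, smul_smul, ← add_smul,
    C.N_swap (rt 1 0) (rt 2 1) (by decide)] at hJ
  have h := C.zsmul_e_injective (rt 3 2) (hJ.trans (zero_smul ℤ _).symm)
  have h1 := mul_pos hC.a_2ab hC.b_3ab
  exact pos_of_mul_pos_right (by linarith) hC.a_b.le

theorem IsExtraspecialPos.N_pos_of_mem (hC : C.IsExtraspecialPos) (r s : Root)
    (h : (r.1, s.1) ∈ positivePairs) : 0 < C.N r s := by
  obtain ⟨r, hr⟩ := r
  obtain ⟨s, hs⟩ := s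
  simp only [positivePairs, List.mem_cons, Prod.mk.injEq, List.not_mem_nil, or_false] at h
  rcases h with ⟨rfl, rfl⟩ | ⟨rfl, rfl⟩ | ⟨rfl, rfl⟩ | ⟨rfl, rfl⟩ | ⟨rfl, rfl⟩
  · exact hC.a_b
  · exact hC.a_ab
  · exact hC.a_2ab
  · exact hC.b_3ab
  · exact hC.two_one

theorem IsExtraspecialPos.N_pos (hC : C.IsExtraspecialPos) {r s : Root} (h : r.1 + s.1 ∈ roots)
    (hp : IsPositive r.1 s.1) : 0 < C.N r s := by
  set p : Root := ⟨_, h⟩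
  have e1 : s.1 + (-p).1 + r.1 = 0 := by
    change s.1 + -(r.1 + s.1) + r.1 = 0
    abel
  have e2 : (-p).1 + r.1 + s.1 = 0 := by rw [← e1]; abel
  -- Rotation has order three, so undoing one step means applying two more.
  have rot : 0 < C.N s (-p) → 0 < C.N r s := fun h =>
    C.N_pos_rotate e2 (C.N_pos_rotate e1 h)
  have rot' : 0 < C.N (-p) r → 0 < C.N r s := C.N_pos_rotate e2
  have neg_neg' : ∀ q : Root, - -q = q := fun q => Subtype.ext (neg_neg q.1)
  rcases hp with hp | hp | hp | hp | hp | hp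
  · exact hC.N_pos_of_mem r s hp
  · exact rot (hC.N_pos_of_mem s (-p) hp)
  · exact rot' (hC.N_pos_of_mem (-p) r hp)
  · have := C.N_pos_neg_swap (r := -s) (s := -r) ?_ (hC.N_pos_of_mem (-s) (-r) hp)
    · rwa [neg_neg', neg_neg'] at this
    · exact add_mem_of_add_eq_zero (q := p) (by
        change -s.1 + -r.1 + (r.1 + s.1) = 0
        abel)
  · have := C.N_pos_neg_swap (r := p) (s := -s) ?_ (hC.N_pos_of_mem p (-s) hp)
    · rw [neg_neg'] at this
      exact rot this
    · exact add_mem_of_add_eq_zero (q := -r) (by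
        change r.1 + s.1 + -s.1 + -r.1 = 0
        abel)
  · have := C.N_pos_neg_swap (r := -r) (s := p) ?_ (hC.N_pos_of_mem (-r) p hp)
    · rw [neg_neg'] at this
      exact rot' this
    · exact add_mem_of_add_eq_zero (q := -s) (by
        change -r.1 + (r.1 + s.1) + -s.1 = 0
        abel)

theorem IsExtraspecialPos.N_eq_structConst (hC : C.IsExtraspecialPos) {r s : Root}
    (h : r.1 + s.1 ∈ roots) : C.N r s = structConst r s := by
  have key : ∀ r s : Root, r.1 + s.1 ∈ roots → IsPositive r.1 s.1 →
      C.N r s = strLen r s + 1 := by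
    intro r s h hp
    obtain ⟨i, hi, hi'⟩ := C.exists_sign r s h
    have h0 := hC.N_pos h hp
    rw [hi'] at h0 ⊢
    have h1 := pos_of_mul_pos_left h0 (by positivity)
    simp only [List.mem_cons, List.not_mem_nil, or_false] at hi
    obtain rfl : i = 1 := by omega
    ring
  unfold structConst
  rcases isPositive_or_swap r s h with hp | ⟨hp, hn⟩
  · rw [if_pos hp, key r s h hp]
  · rw [if_neg hn, ← strLen_comm_of_add_mem r s h, ← key s r (add_comm r.1 s.1 ▸ h) hp,
      C.N_swap r s h, neg_neg]

end ChevalleyBasis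

/-! ### Integer matrices of the divided powers -/

/-- `(ad e_r)^i / i! (e_s)` for `s ≠ -r`, as a list of at most one multiple of a root vector. -/
def stringCoord (r : Root) : ℕ → Root → List (ℤ × Root)
  | 0, s => [(1, s)]
  | i + 1, s => (stringCoord r i s).flatMap fun p =>
      if h : r.1 + p.2.1 ∈ roots then [(p.1 * structConst r p.2 / (i + 1), ⟨r.1 + p.2.1, h⟩)]
      else []

/-- The coordinates of `(ad e_r)^i / i! (v)` for `v` in the Chevalley basis. -/
def divPowCoord (r : Root) : ℕ → Fin 2 ⊕ Root → List (ℤ × (Fin 2 ⊕ Root))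
  | 0, k => [(1, k)]
  | 1, Sum.inl k => [(-cartanInt (![rt 1 0, rt 0 1] k) r, Sum.inr r)]
  | _ + 2, Sum.inl _ => []
  | i + 1, Sum.inr s =>
    if s = -r then
      match i with
      | 0 => [(corootA r, Sum.inl 0), (corootB r, Sum.inl 1)]
      | 1 => [(-1, Sum.inr r)]
      | _ + 2 => []
    else (stringCoord r (i + 1) s).map fun p => (p.1, Sum.inr p.2)

/-- Makes the integer division in `stringCoord` exact, and excludes reaching `-r`, where the next
bracket would leave the root vectors. -/
theorem dvd_stringCoord : ∀ r s : Root, s ≠ -r → ∀ i < 3, ∀ p ∈ stringCoord r i s,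
    r.1 + p.2.1 ≠ 0 ∧ (r.1 + p.2.1 ∈ roots → ((i : ℤ) + 1) ∣ p.1 * structConst r p.2) := by
  decide +kernel

/-- The roots in the order of the rows of `actionTable`. -/
def rootList : List Root :=
  [rt 1 0, rt 0 1, rt 1 1, rt 2 1, rt 3 1, rt 3 2,
   rt (-1) 0, rt 0 (-1), rt (-1) (-1), rt (-2) (-1), rt (-3) (-1), rt (-3) (-2)]

/-- The Chevalley basis in the order of the columns of `actionTable`. -/
def basisList : List (Fin 2 ⊕ Root) := Sum.inl 0 :: Sum.inl 1 :: rootList.map Sum.inr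

/-- The action of the root vectors: the row of `r` and the column of the basis vector `v` hold the
triples `(i, c, k)` with `i ≠ 0`, `c ≠ 0` for which `(ad e_r)^i / i! (v)` has coordinate `c` at
the basis vector of index `k`. -/
def actionTable : List (List (List (ℕ × ℤ × ℕ))) :=
  [[[(1, -2, 2)], [(1, 1, 2)], [], [(1, 1, 4), (2, 1, 5), (3, 1, 6)], [(1, 2, 5), (2, 3, 6)],
    [(1, 3, 6)], [], [], [(1, 1, 0), (2, -1, 2)], [], [(1, -3, 9)], [(1, -2, 10), (2, 3, 9)],
    [(1, -1, 11), (2, 1, 10), (3, -1, 9)], []],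
   [[(1, 3, 3)], [(1, -2, 3)], [(1, -1, 4)], [], [], [], [(1, 1, 7)], [], [],
    [(1, 1, 1), (2, -1, 3)], [(1, 1, 8)], [], [], [(1, -1, 12)]],
   [[(1, 1, 4)], [(1, -1, 4)], [(1, -2, 5), (2, 3, 7)], [], [], [(1, -3, 7)], [], [],
    [(1, -3, 3)], [(1, 1, 2), (2, -1, 5), (3, 1, 7)], [(1, 1, 0), (1, 3, 1), (2, -1, 4)],
    [(1, 2, 8), (2, -3, 3)], [], [(1, 1, 11), (2, 1, 8), (3, -1, 3)]],
   [[(1, -1, 5)], [], [(1, -3, 6)], [], [(1, 3, 7)], [], [], [], [(1, -2, 4), (2, -3, 7)], [],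
    [(1, 2, 2), (2, -3, 6)], [(1, 2, 0), (1, 3, 1), (2, -1, 5)],
    [(1, 1, 8), (2, -1, 4), (3, -1, 7)], [(1, -1, 10), (2, -1, 2), (3, 1, 6)]],
   [[(1, -3, 6)], [(1, 1, 6)], [], [(1, -1, 7)], [], [], [], [], [(1, -1, 5)], [], [],
    [(1, 1, 2)], [(1, 1, 0), (1, 1, 1), (2, -1, 6)], [(1, 1, 9)]],
   [[], [(1, -1, 7)], [], [], [], [], [], [], [], [(1, -1, 6)], [(1, 1, 5)], [(1, -1, 4)],
    [(1, 1, 3)], [(1, 1, 0), (1, 2, 1), (2, -1, 7)]],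
   [[(1, 2, 8)], [(1, -1, 8)], [(1, -1, 0), (2, -1, 8)], [], [(1, 3, 3)],
    [(1, 2, 4), (2, 3, 3)], [(1, 1, 5), (2, 1, 4), (3, 1, 3)], [], [],
    [(1, -1, 10), (2, 1, 11), (3, -1, 12)], [(1, -2, 11), (2, 3, 12)], [(1, -3, 12)], [], []],
   [[(1, -3, 9)], [(1, 2, 9)], [], [(1, -1, 1), (2, -1, 9)], [(1, -1, 2)], [], [], [(1, 1, 6)],
    [(1, 1, 10)], [], [], [], [(1, -1, 13)], []],
   [[(1, -1, 10)], [(1, 1, 10)], [(1, 3, 9)], [(1, -1, 8), (2, -1, 11), (3, -1, 13)],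
    [(1, -1, 0), (1, -3, 1), (2, -1, 10)], [(1, -2, 2), (2, -3, 9)], [],
    [(1, -1, 5), (2, 1, 2), (3, 1, 9)], [(1, 2, 11), (2, 3, 13)], [], [], [(1, 3, 13)], [], []],
   [[(1, 1, 11)], [], [(1, 2, 10), (2, -3, 13)], [], [(1, -2, 8), (2, -3, 12)],
    [(1, -2, 0), (1, -3, 1), (2, -1, 11)], [(1, -1, 2), (2, -1, 10), (3, 1, 13)],
    [(1, 1, 4), (2, -1, 8), (3, -1, 12)], [(1, 3, 12)], [], [(1, -3, 13)], [], [], []],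
   [[(1, 3, 12)], [(1, -1, 12)], [(1, 1, 11)], [], [], [(1, -1, 8)],
    [(1, -1, 0), (1, -1, 1), (2, -1, 12)], [(1, -1, 3)], [], [(1, 1, 13)], [], [], [], []],
   [[], [(1, 1, 13)], [], [(1, 1, 12)], [(1, -1, 11)], [(1, 1, 10)], [(1, -1, 9)],
    [(1, -1, 0), (1, -2, 1), (2, -1, 13)], [], [], [], [], [], []]]

instance : DecidableEq (ℕ × ℤ × Option (Fin 2 ⊕ Root)) :=
  @instDecidableEqProd _ _ _ (@instDecidableEqProd _ _ _ Option.instDecidableEq)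

/-- Certifies the literal table against the recursive formula, so later computations only look
entries up. Zero coordinates are dropped; comparing `Option` values also rules out invalid indices
in the table. -/
theorem actionTable_eq : ∀ r : Root, ∀ k < 14,
    (basisList[k]?.map fun b => [1, 2, 3].flatMap fun i =>
      ((divPowCoord r i b).filter fun q => q.1 ≠ 0).map fun q => (i, q.1, some q.2)) =
    some (((actionTable.getD (rootList.idxOf r) []).getD k []).map
      fun q => (q.1, q.2.1, basisList[q.2.2]?)) := by
  decide +kernel

theorem actionTable_eq_nil : ∀ r : Root, ∀ k, 14 ≤ k →
    (actionTable.getD (rootList.idxOf r) []).getD k [] = [] := by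
  intro r k hk
  have : ∀ r : Root, (actionTable.getD (rootList.idxOf r) []).length ≤ 14 := by decide +kernel
  exact List.getD_eq_default _ _ ((this r).trans hk)

namespace ChevalleyBasis

variable {L : Type*} [LieRing L] [LieAlgebra ℂ L] (C : ChevalleyBasis L)

/-- The Chevalley basis. -/
def vec : Fin 2 ⊕ Root → L := Sum.elim ![C.h (rt 1 0), C.h (rt 0 1)] C.e

theorem vec_inl (k : Fin 2) : C.vec (Sum.inl k) = C.h (![rt 1 0, rt 0 1] k) := by
  fin_cases k <;> rfl

variable {C}

theorem IsExtraspecialPos.divPow_e_eq (hC : C.IsExtraspecialPos) {r s : Root} (hs : s ≠ -r)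
    {i : ℕ} (hi : i ≤ 3) :
    C.divPow r i (C.e s) = ((stringCoord r i s).map fun p => p.1 • C.e p.2).sum := by
  induction i with
  | zero => simp [stringCoord, divPow_zero]
  | succ i ih =>
    have hd := dvd_stringCoord r s hs i (by omega)
    rw [divPow_succ, ih (by omega), stringCoord]
    generalize stringCoord r i s = l at hd
    induction l with
    | nil => simp
    | cons p l ihl =>
      simp only [List.mem_cons, forall_eq_or_imp] at hd
      obtain ⟨⟨h0, hdvd⟩, hl⟩ := hd
      simp only [List.map_cons, List.sum_cons, lie_add, smul_add, List.flatMap_cons,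
        List.map_append, List.sum_append, ihl hl]
      congr 1
      by_cases hm : r.1 + p.2.1 ∈ roots
      · obtain ⟨m, hm'⟩ := hdvd hm
        have hi0 : ((i : ℤ) + 1) ≠ 0 := by positivity
        have hi1 : ((i : ℂ) + 1) ≠ 0 := by exact_mod_cast hi0
        simp only [dif_pos hm, List.map_cons, List.map_nil, List.sum_cons, List.sum_nil,
          add_zero, lie_zsmul, C.lie_e_e r p.2 ⟨_, hm⟩ rfl, hC.N_eq_structConst hm, smul_smul]
        -- The exact quotient `m` over `ℤ` cancels the factor `(i + 1)⁻¹` over `ℂ`.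
        rw [hm', Int.mul_ediv_cancel_left _ hi0, mul_smul,
          ← Int.cast_smul_eq_zsmul ℂ ((i : ℤ) + 1), smul_smul]
        push_cast
        rw [inv_mul_cancel₀ hi1, one_smul]
      · simp [dif_neg hm, C.lie_e_e_eq_zero r p.2 h0 hm]

theorem IsExtraspecialPos.divPow_vec (hC : C.IsExtraspecialPos) (r : Root) (k : Fin 2 ⊕ Root)
    {i : ℕ} (hi : i ≤ 3) :
    C.divPow r i (C.vec k) = ((divPowCoord r i k).map fun p => p.1 • C.vec p.2).sum := by
  match i, k with
  | 0, k => simp [divPowCoord, divPow_zero]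
  | 1, Sum.inl k =>
    rw [divPow_succ, divPow_zero, Module.End.one_apply, vec_inl, ← lie_skew, C.lie_h_e]
    simp [divPowCoord, vec]
  | i + 2, Sum.inl k =>
    rw [vec_inl, C.divPow_eq_zero_of_le r _ (by omega) (C.divPow_h r _).2]
    simp [divPowCoord]
  | i + 1, Sum.inr s =>
    change C.divPow r (i + 1) (C.e s) = _
    by_cases hs : s = -r
    · subst hs
      have h1 : C.divPow r 1 (C.e (-r)) = C.h r := by
        rw [divPow_succ, divPow_zero, Module.End.one_apply, C.lie_e_neg]; simp
      match i with
      | 0 =>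
        rw [h1, C.h_eq r]
        simp [divPowCoord, vec]
      | 1 =>
        rw [divPow_succ, h1, ← lie_skew, C.lie_h_e, cartanInt_self,
          ← Int.cast_smul_eq_zsmul ℂ, smul_neg, smul_smul]
        norm_num [divPowCoord, vec]
      | i + 2 =>
        rw [C.divPow_eq_zero_of_le r _ (by omega) (C.divPow_neg r).2.2]
        simp [divPowCoord]
    · rw [hC.divPow_e_eq hs hi]
      simp [divPowCoord, hs, vec, Function.comp_def]

end ChevalleyBasis

/-! ### Symbolic computation with coefficients in `ℤ[t, u]` -/

/-- The element `c tⁱ uʲ v` of `L_K`, for an element `v` of the Chevalley basis given by its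
index in `basisList`. -/
structure Term where
  coeff : ℤ
  degT : ℕ
  degU : ℕ
  index : ℕ

/-- The root element `x_r(c tⁱ uʲ)`. -/
structure Letter where
  root : Root
  coeff : ℤ
  degT : ℕ
  degU : ℕ

/-- The argument `c tⁱ uʲ` of a root element. -/
def Letter.arg {K : Type*} [CommRing K] (t u : K) (x : Letter) : K :=
  (x.coeff : K) * t ^ x.degT * u ^ x.degU

/-- The action of a root element on a sum of terms. -/
def Letter.apply (x : Letter) (l : List Term) : List Term :=
  l.flatMap fun p => p :: ((actionTable.getD (rootList.idxOf x.root) []).getD p.index []).map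
    fun q => ⟨p.coeff * q.2.1 * x.coeff ^ q.1, p.degT + q.1 * x.degT, p.degU + q.1 * x.degU, q.2.2⟩

/-- Add a term to a sum of terms, collecting like terms. -/
def addTerm (p : Term) : List Term → List Term
  | [] => [p]
  | q :: l =>
    if p.index = q.index ∧ p.degT = q.degT ∧ p.degU = q.degU then
      ⟨p.coeff + q.coeff, q.degT, q.degU, q.index⟩ :: l
    else q :: addTerm p l

/-- Collect like terms. -/
def collect (l : List Term) : List Term := l.foldr addTerm []

/-- The image of a basis vector under a product of root elements. -/
def wordApply (w : List Letter) (k : ℕ) : List Term := w.foldr Letter.apply [⟨1, 0, 0, k⟩]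

/-- Equality of two sums of terms after collecting like terms. -/
def agree (l m : List Term) : Bool :=
  (collect (l ++ m.map fun p => ⟨-p.coeff, p.degT, p.degU, p.index⟩)).all fun p => p.coeff = 0

/-- The relation `x_r(u) x_s(t) = x_s(t) x_r(u) w` holds on the Chevalley basis. -/
def CommRel (r s : Root) (w : List Letter) : Prop :=
  ∀ k < 14, agree (wordApply [⟨r, 1, 0, 1⟩, ⟨s, 1, 1, 0⟩] k)
    (wordApply (⟨s, 1, 1, 0⟩ :: ⟨r, 1, 0, 1⟩ :: w) k) = true

instance (r s : Root) (w : List Letter) : Decidable (CommRel r s w) := by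
  unfold CommRel; infer_instance

theorem exists_basisList_getElem? : ∀ b : Fin 2 ⊕ Root, ∃ k < 14, basisList[k]? = some b := by
  decide +kernel

/-! ### Evaluation of the symbolic computation in `L_K` -/

namespace ChevalleyBasis

noncomputable section

variable {L : Type*} [LieRing L] [LieAlgebra ℂ L] (C : ChevalleyBasis L)

/-- The Chevalley basis of `L_ℤ`. -/
def latticeVec (b : Fin 2 ⊕ Root) : C.lattice := ⟨C.vec b, Submodule.subset_span ⟨b, rfl⟩⟩

variable {C} in
theorem IsExtraspecialPos.intDivPow_latticeVec (hC : C.IsExtraspecialPos) (r : Root)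
    (b : Fin 2 ⊕ Root) {i : ℕ} (hi : i ≤ 3) :
    C.intDivPow r i (C.latticeVec b) =
      ((divPowCoord r i b).map fun p => p.1 • C.latticeVec p.2).sum := by
  apply Subtype.ext
  change C.divPow r i (C.vec b) = C.lattice.subtype _
  rw [hC.divPow_vec r b hi, map_list_sum, List.map_map]
  rfl

variable {K : Type*} [CommRing K]

variable (K) in
/-- The Chevalley basis of `L_K`. -/
def formVec (b : Fin 2 ⊕ Root) : C.Form K := 1 ⊗ₜ C.latticeVec b

variable (K) in
/-- The element of the Chevalley basis of `L_K` of index `k` in `basisList`. -/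
def indexVec (k : ℕ) : C.Form K := basisList[k]?.elim 0 (C.formVec K)

/-- Only spanning is needed: the vectors `1 ⊗ v`, with `v` in the Chevalley basis, generate `L_K`
over `K`. -/
theorem form_end_ext {f g : Module.End K (C.Form K)}
    (h : ∀ k < 14, f (C.indexVec K k) = g (C.indexVec K k)) : f = g := by
  have hb : ∀ b, f (C.formVec K b) = g (C.formVec K b) := by
    intro b
    obtain ⟨k, hk, hb⟩ := exists_basisList_getElem? b
    simpa [indexVec, hb] using h k hk
  have hl : ∀ v : L, ∀ hv : v ∈ C.lattice, f (1 ⊗ₜ ⟨v, hv⟩) = g (1 ⊗ₜ ⟨v, hv⟩) := by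
    intro v hv
    induction hv using Submodule.span_induction with
    | mem x hx =>
      obtain ⟨b, rfl⟩ := hx
      exact hb b
    | zero =>
      have : (⟨0, zero_mem _⟩ : C.lattice) = 0 := rfl
      rw [this, TensorProduct.tmul_zero, map_zero, map_zero]
    | add x y hx hy ihx ihy =>
      have : (⟨x + y, add_mem hx hy⟩ : C.lattice) = ⟨x, hx⟩ + ⟨y, hy⟩ := rfl
      rw [this, TensorProduct.tmul_add, map_add, map_add, ihx, ihy]
    | smul n x hx ih =>
      have : (⟨n • x, Submodule.smul_mem _ n hx⟩ : C.lattice) = n • ⟨x, hx⟩ := rfl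
      rw [this, TensorProduct.tmul_smul, map_zsmul, map_zsmul, ih]
  ext v
  exact hl v.1 v.2

theorem list_sum_filter_ne_zero {β : Type*} (F : β → C.Form K) (z : K) (i : ℕ)
    (l : List (ℤ × β)) :
    ((l.filter fun q => q.1 ≠ 0).map fun q => ((q.1 : K) * z ^ i) • F q.2).sum =
      (l.map fun q => ((q.1 : K) * z ^ i) • F q.2).sum := by
  induction l with
  | nil => rfl
  | cons q l ih =>
    by_cases hq : q.1 = 0 <;> simp_all

variable {C}

/-- The term `i = 0` of the exponential is split off; the list is kept in the shape of
`actionTable_eq`, so that the table can be substituted for it. -/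
theorem IsExtraspecialPos.rootEnd_formVec (hC : C.IsExtraspecialPos) (r : Root) (z : K)
    (b : Fin 2 ⊕ Root) :
    C.rootEnd r z (C.formVec K b) = C.formVec K b +
      (([1, 2, 3].flatMap fun i => ((divPowCoord r i b).filter fun q => q.1 ≠ 0).map
        fun q => (i, q.1, some q.2)).map
        fun q => ((q.2.1 : K) * z ^ q.1) • q.2.2.elim 0 (C.formVec K)).sum := by
  have key : ∀ i ≤ 3, z ^ i • (C.intDivPow r i).baseChange K (C.formVec K b) =
      ((divPowCoord r i b).map fun q => ((q.1 : K) * z ^ i) • C.formVec K q.2).sum := by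
    intro i hi
    rw [formVec, LinearMap.baseChange_tmul, hC.intDivPow_latticeVec r b hi]
    generalize divPowCoord r i b = l
    induction l with
    | nil => simp
    | cons q l ih =>
      simp only [List.map_cons, List.sum_cons, TensorProduct.tmul_add, smul_add, ih,
        TensorProduct.tmul_smul, formVec, ← Int.cast_smul_eq_zsmul K, smul_smul, mul_comm]
  simp only [rootEnd, LinearMap.sum_apply, LinearMap.smul_apply]
  rw [Finset.sum_range_succ', Finset.sum_range_succ, Finset.sum_range_succ, Finset.sum_range_one]
  simp only [Nat.reduceAdd, zero_add]
  rw [key 1 (by norm_num), key 2 (by norm_num), key 3 (by norm_num), key 0 (by norm_num)]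
  simp only [List.flatMap_cons, List.flatMap_nil, List.append_nil, List.map_append,
    List.sum_append, List.map_map, Function.comp_def, Option.elim_some, list_sum_filter_ne_zero]
  simp only [divPowCoord, List.map_cons, List.map_nil, List.sum_cons, List.sum_nil]
  simp only [Int.cast_one, pow_zero, mul_one, one_smul, add_zero]
  abel

theorem IsExtraspecialPos.rootEnd_indexVec (hC : C.IsExtraspecialPos) (r : Root) (z : K)
    (k : ℕ) :
    C.rootEnd r z (C.indexVec K k) = C.indexVec K k +
      (((actionTable.getD (rootList.idxOf r) []).getD k []).map
        fun q => ((q.2.1 : K) * z ^ q.1) • C.indexVec K q.2.2).sum := by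
  by_cases hk : k < 14
  · have h := actionTable_eq r k hk
    obtain ⟨b, hb⟩ : ∃ b, basisList[k]? = some b :=
      ⟨_, List.getElem?_eq_getElem (show k < basisList.length from hk)⟩
    rw [hb, Option.map_some, Option.some.injEq] at h
    have hv : C.indexVec K k = C.formVec K b := by rw [indexVec, hb, Option.elim_some]
    rw [hv, hC.rootEnd_formVec r z b, h, List.map_map]
    rfl
  -- Out-of-range indices denote the zero vector and have empty table entries, so no bound on term
  -- indices need be carried along.
  · have hk' : 14 ≤ k := not_lt.mp hk
    have hb : basisList[k]? = none := List.getElem?_eq_none hk'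
    rw [actionTable_eq_nil r k hk']
    simp [indexVec, hb]

variable (C)

/-- The value of a sum of terms in `L_K`. -/
def evalTerms (t u : K) (l : List Term) : C.Form K :=
  (l.map fun p => ((p.coeff : K) * t ^ p.degT * u ^ p.degU) • C.indexVec K p.index).sum

theorem evalTerms_nil (t u : K) : C.evalTerms t u [] = 0 := rfl

theorem evalTerms_cons (t u : K) (p : Term) (l : List Term) : C.evalTerms t u (p :: l) =
    ((p.coeff : K) * t ^ p.degT * u ^ p.degU) • C.indexVec K p.index + C.evalTerms t u l := by
  rw [evalTerms, evalTerms, List.map_cons, List.sum_cons]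

theorem evalTerms_append (t u : K) (l m : List Term) :
    C.evalTerms t u (l ++ m) = C.evalTerms t u l + C.evalTerms t u m := by
  simp [evalTerms]

theorem evalTerms_addTerm (t u : K) (p : Term) (l : List Term) :
    C.evalTerms t u (addTerm p l) = C.evalTerms t u (p :: l) := by
  induction l with
  | nil => rfl
  | cons q l ih =>
    unfold addTerm
    split_ifs with h
    · obtain ⟨h1, h2, h3⟩ := h
      simp only [evalTerms_cons, h1, h2, h3, Int.cast_add]
      module
    · rw [evalTerms_cons, ih, evalTerms_cons, evalTerms_cons, evalTerms_cons]
      abel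

theorem evalTerms_collect (t u : K) (l : List Term) :
    C.evalTerms t u (collect l) = C.evalTerms t u l := by
  induction l with
  | nil => rfl
  | cons p l ih =>
    change C.evalTerms t u (addTerm p (collect l)) = _
    rw [evalTerms_addTerm, evalTerms_cons, evalTerms_cons, ih]

theorem evalTerms_neg (t u : K) (l : List Term) :
    C.evalTerms t u (l.map fun p => ⟨-p.coeff, p.degT, p.degU, p.index⟩) =
      -C.evalTerms t u l := by
  induction l with
  | nil => simp [evalTerms]
  | cons p l ih =>
    simp only [List.map_cons, evalTerms_cons, ih, Int.cast_neg]
    module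

/-- The formal difference has all integer coefficients zero after collection, hence vanishes for any
`t, u` in any `K`. -/
theorem evalTerms_eq_of_agree (t u : K) {l m : List Term} (h : agree l m = true) :
    C.evalTerms t u l = C.evalTerms t u m := by
  have hz : ∀ l : List Term, (∀ p ∈ l, p.coeff = 0) → C.evalTerms t u l = 0 := by
    intro l hl
    refine List.sum_eq_zero fun x hx => ?_
    obtain ⟨p, hp, rfl⟩ := List.mem_map.mp hx
    simp [hl p hp]
  have h1 := hz _ (by simpa [agree] using h)
  rwa [evalTerms_collect, evalTerms_append, evalTerms_neg, add_neg_eq_zero] at h1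

variable {C}

/-- Soundness of the symbolic action: replacing `z` by `c tᵐ uⁿ` turns `zⁱ` into `cⁱ tⁱᵐ uⁱⁿ`, which
is how `Letter.apply` updates coefficients and degrees. -/
theorem IsExtraspecialPos.rootEnd_evalTerms (hC : C.IsExtraspecialPos) (t u : K) (x : Letter)
    (l : List Term) :
    C.rootEnd x.root (x.arg t u) (C.evalTerms t u l) = C.evalTerms t u (x.apply l) := by
  induction l with
  | nil => simp [Letter.apply, evalTerms_nil]
  | cons p l ih =>
    have hc : x.apply (p :: l) = (p :: ((actionTable.getD (rootList.idxOf x.root) []).getD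
        p.index []).map fun q => ⟨p.coeff * q.2.1 * x.coeff ^ q.1, p.degT + q.1 * x.degT,
          p.degU + q.1 * x.degU, q.2.2⟩) ++ x.apply l := List.flatMap_cons
    rw [hc, evalTerms_append, ← ih, evalTerms_cons, map_add, map_smul, hC.rootEnd_indexVec,
      evalTerms_cons, smul_add]
    congr 2
    rw [evalTerms, List.map_map, List.smul_sum, List.map_map]
    congr 1
    refine List.map_congr_left fun q _ => ?_
    simp only [Function.comp_apply, smul_smul, Letter.arg]
    congr 1
    push_cast
    ring

/-- The root elements of the Chevalley group. -/
def rootElt (C : ChevalleyBasis L) (r : Root) (z : K) : C.chevalleyGroup K :=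
  ⟨C.rootAut r z, Subgroup.subset_closure ⟨r, z, rfl⟩⟩

theorem IsExtraspecialPos.prod_apply_indexVec (hC : C.IsExtraspecialPos) (t u : K)
    (w : List Letter) (k : ℕ) :
    ((w.map fun x => C.rootElt x.root (x.arg t u)).prod : C.Form K ≃ₗ[K] C.Form K)
      (C.indexVec K k) = C.evalTerms t u (wordApply w k) := by
  induction w with
  | nil => simp [wordApply, evalTerms]
  | cons x w ih =>
    rw [List.map_cons, List.prod_cons, Subgroup.coe_mul, LinearEquiv.mul_apply, ih]
    exact hC.rootEnd_evalTerms t u x _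

/-- The commutator identity is multiplied out to `gh = hg w`, which contains no inverses and can be
tested on basis vectors. -/
theorem IsExtraspecialPos.comm_rootElt (hC : C.IsExtraspecialPos) (t u : K) (r s : Root)
    (w : List Letter) (h : CommRel r s w) :
    comm (C.rootElt r u) (C.rootElt s t) =
      (w.map fun x => C.rootElt x.root (x.arg t u)).prod := by
  have key : C.rootElt r u * C.rootElt s t = C.rootElt s t * C.rootElt r u *
      (w.map fun x => C.rootElt x.root (x.arg t u)).prod := by
    have hr : (Letter.mk r 1 0 1).arg t u = u := by simp [Letter.arg]
    have hs : (Letter.mk s 1 1 0).arg t u = t := by simp [Letter.arg]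
    have h1 := hC.prod_apply_indexVec t u [⟨r, 1, 0, 1⟩, ⟨s, 1, 1, 0⟩]
    have h2 := hC.prod_apply_indexVec t u (⟨s, 1, 1, 0⟩ :: ⟨r, 1, 0, 1⟩ :: w)
    simp only [List.map_cons, List.map_nil, List.prod_cons, List.prod_nil, mul_one, hr, hs,
      ← mul_assoc] at h1 h2
    refine Subtype.ext (LinearEquiv.toLinearMap_injective (C.form_end_ext fun k hk => ?_))
    exact (h1 k).trans ((C.evalTerms_eq_of_agree t u (h k hk)).trans (h2 k).symm)
  rw [comm, mul_assoc, key]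
  group

theorem x_eq_rootElt (m n : ℤ) (z : K) (h : (m, n) ∈ roots) :
    C.x m n z h = C.rootElt (rt m n h) z := rfl

end

end ChevalleyBasis

end G2

/-! ### The commutator relations -/

set_option maxHeartbeats 1600000 in
theorem mainTheorem4 {L : Type*} [LieRing L] [LieAlgebra ℂ L] (C : ChevalleyBasis L)
    (hab : 0 < C.N (rt 1 0) (rt 0 1)) (ha_ab : 0 < C.N (rt 1 0) (rt 1 1))
    (ha_2ab : 0 < C.N (rt 1 0) (rt 2 1)) (hb_3ab : 0 < C.N (rt 0 1) (rt 3 1))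
    {K : Type*} [CommRing K] (t u : K) :
    comm (C.x 0 1 u) (C.x 1 0 t) =
      C.x 1 1 (-(t * u)) * C.x 2 1 (t ^ 2 * u) * C.x 3 1 (-(t ^ 3 * u)) *
        C.x 3 2 (-(t ^ 3 * u ^ 2)) ∧
    comm (C.x 1 0 u) (C.x 0 1 t) =
      C.x 1 1 (t * u) * C.x 2 1 (-(t * u ^ 2)) * C.x 3 1 (t * u ^ 3) *
        C.x 3 2 (-(2 * t ^ 2 * u ^ 3)) ∧
    comm (C.x 1 1 u) (C.x 1 0 t) =
      C.x 2 1 (-(2 * t * u)) * C.x 3 1 (3 * t ^ 2 * u) * C.x 3 2 (-(3 * t * u ^ 2)) ∧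
    comm (C.x 2 1 u) (C.x 1 0 t) =
      C.x 3 1 (-(3 * t * u)) ∧
    comm (C.x 3 1 u) (C.x 0 1 t) =
      C.x 3 2 (-(t * u)) ∧
    comm (C.x 2 1 u) (C.x 1 1 t) =
      C.x 3 2 (3 * t * u) ∧
    comm (C.x 0 (-1) u) (C.x (-1) 0 t) =
      C.x (-1) (-1) (t * u) * C.x (-2) (-1) (t ^ 2 * u) *
        C.x (-3) (-1) (t ^ 3 * u) * C.x (-3) (-2) (-(t ^ 3 * u ^ 2)) ∧
    comm (C.x (-1) 0 u) (C.x 0 (-1) t) =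
      C.x (-1) (-1) (-(t * u)) * C.x (-2) (-1) (-(t * u ^ 2)) *
        C.x (-3) (-1) (-(t * u ^ 3)) * C.x (-3) (-2) (-(2 * t ^ 2 * u ^ 3)) ∧
    comm (C.x (-1) (-1) u) (C.x (-1) 0 t) =
      C.x (-2) (-1) (2 * t * u) * C.x (-3) (-1) (3 * t ^ 2 * u) *
        C.x (-3) (-2) (-(3 * t * u ^ 2)) ∧
    comm (C.x (-2) (-1) u) (C.x (-1) 0 t) =
      C.x (-3) (-1) (3 * t * u) ∧
    comm (C.x (-3) (-1) u) (C.x 0 (-1) t) =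
      C.x (-3) (-2) (t * u) ∧
    comm (C.x (-2) (-1) u) (C.x (-1) (-1) t) =
      C.x (-3) (-2) (-(3 * t * u)) ∧
    comm (C.x (-1) (-1) u) (C.x 1 0 t) =
      C.x 0 (-1) (3 * t * u) ∧
    comm (C.x (-2) (-1) u) (C.x 1 0 t) =
      C.x (-1) (-1) (2 * t * u) * C.x 0 (-1) (3 * t ^ 2 * u) *
        C.x (-3) (-2) (3 * t * u ^ 2) ∧
    comm (C.x (-3) (-1) u) (C.x 1 0 t) =
      C.x (-2) (-1) (t * u) * C.x (-1) (-1) (t ^ 2 * u) *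
        C.x 0 (-1) (t ^ 3 * u) * C.x (-3) (-2) (t ^ 3 * u ^ 2) ∧
    comm (C.x 1 0 u) (C.x (-3) (-1) t) =
      C.x (-2) (-1) (-(t * u)) * C.x (-1) (-1) (-(t * u ^ 2)) *
        C.x 0 (-1) (-(t * u ^ 3)) * C.x (-3) (-2) (2 * t ^ 2 * u ^ 3) ∧
    comm (C.x 0 1 u) (C.x (-1) (-1) t) =
      C.x (-1) 0 (t * u) * C.x (-2) (-1) (-(t ^ 2 * u)) *
        C.x (-3) (-2) (t ^ 3 * u) * C.x (-3) (-1) (-(t ^ 3 * u ^ 2)) ∧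
    comm (C.x (-1) (-1) u) (C.x 0 1 t) =
      C.x (-1) 0 (-(t * u)) * C.x (-2) (-1) (t * u ^ 2) *
        C.x (-3) (-2) (-(t * u ^ 3)) * C.x (-3) (-1) (-(2 * t ^ 2 * u ^ 3)) ∧
    comm (C.x (-3) (-2) u) (C.x 0 1 t) =
      C.x (-3) (-1) (t * u) ∧
    comm (C.x (-1) 0 u) (C.x 1 1 t) =
      C.x 0 1 (3 * t * u) ∧
    comm (C.x 0 (-1) u) (C.x 1 1 t) =
      C.x 1 0 (-(t * u)) * C.x 2 1 (-(t ^ 2 * u)) * C.x 3 2 (-(t ^ 3 * u)) *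
        C.x 3 1 (-(t ^ 3 * u ^ 2)) ∧
    comm (C.x 1 1 u) (C.x 0 (-1) t) =
      C.x 1 0 (t * u) * C.x 2 1 (t * u ^ 2) * C.x 3 2 (t * u ^ 3) *
        C.x 3 1 (-(2 * t ^ 2 * u ^ 3)) ∧
    comm (C.x (-2) (-1) u) (C.x 1 1 t) =
      C.x (-1) 0 (-(2 * t * u)) * C.x 0 1 (-(3 * t ^ 2 * u)) *
        C.x (-3) (-1) (3 * t * u ^ 2) ∧
    comm (C.x (-3) (-2) u) (C.x 1 1 t) =
      C.x (-2) (-1) (-(t * u)) * C.x (-1) 0 (t ^ 2 * u) * C.x 0 1 (t ^ 3 * u) *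
        C.x (-3) (-1) (t ^ 3 * u ^ 2) ∧
    comm (C.x 1 1 u) (C.x (-3) (-2) t) =
      C.x (-2) (-1) (t * u) * C.x (-1) 0 (-(t * u ^ 2)) *
        C.x 0 1 (-(t * u ^ 3)) * C.x (-3) (-1) (2 * t ^ 2 * u ^ 3) ∧
    comm (C.x (-1) 0 u) (C.x 2 1 t) =
      C.x 1 1 (2 * t * u) * C.x 3 2 (-(3 * t ^ 2 * u)) * C.x 0 1 (-(3 * t * u ^ 2)) ∧
    comm (C.x (-1) (-1) u) (C.x 2 1 t) =
      C.x 1 0 (-(2 * t * u)) * C.x 3 1 (-(3 * t ^ 2 * u)) *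
        C.x 0 (-1) (3 * t * u ^ 2) ∧
    comm (C.x (-3) (-1) u) (C.x 2 1 t) =
      C.x (-1) 0 (-(t * u)) * C.x 1 1 (-(t ^ 2 * u)) * C.x 3 2 (t ^ 3 * u) *
        C.x 0 1 (-(t ^ 3 * u ^ 2)) ∧
    comm (C.x 2 1 u) (C.x (-3) (-1) t) =
      C.x (-1) 0 (t * u) * C.x 1 1 (t * u ^ 2) * C.x 3 2 (-(t * u ^ 3)) *
        C.x 0 1 (-(2 * t ^ 2 * u ^ 3)) ∧
    comm (C.x (-3) (-2) u) (C.x 2 1 t) =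
      C.x (-1) (-1) (t * u) * C.x 1 0 (-(t ^ 2 * u)) * C.x 3 1 (-(t ^ 3 * u)) *
        C.x 0 (-1) (t ^ 3 * u ^ 2) ∧
    comm (C.x 2 1 u) (C.x (-3) (-2) t) =
      C.x (-1) (-1) (-(t * u)) * C.x 1 0 (t * u ^ 2) * C.x 3 1 (t * u ^ 3) *
        C.x 0 (-1) (2 * t ^ 2 * u ^ 3) ∧
    comm (C.x (-1) 0 u) (C.x 3 1 t) =
      C.x 2 1 (t * u) * C.x 1 1 (-(t * u ^ 2)) * C.x 0 1 (t * u ^ 3) *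
        C.x 3 2 (2 * t ^ 2 * u ^ 3) ∧
    comm (C.x 3 1 u) (C.x (-1) 0 t) =
      C.x 2 1 (-(t * u)) * C.x 1 1 (t ^ 2 * u) * C.x 0 1 (-(t ^ 3 * u)) *
        C.x 3 2 (t ^ 3 * u ^ 2) ∧
    comm (C.x (-2) (-1) u) (C.x 3 1 t) =
      C.x 1 0 (-(t * u)) * C.x (-1) (-1) (t * u ^ 2) *
        C.x (-3) (-2) (t * u ^ 3) * C.x 0 (-1) (-(2 * t ^ 2 * u ^ 3)) ∧
    comm (C.x 3 1 u) (C.x (-2) (-1) t) =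
      C.x 1 0 (t * u) * C.x (-1) (-1) (-(t ^ 2 * u)) *
        C.x (-3) (-2) (-(t ^ 3 * u)) * C.x 0 (-1) (-(t ^ 3 * u ^ 2)) ∧
    comm (C.x (-3) (-2) u) (C.x 3 1 t) =
      C.x 0 (-1) (-(t * u)) ∧
    comm (C.x (-1) (-1) u) (C.x 3 2 t) =
      C.x 2 1 (-(t * u)) * C.x 1 0 (-(t * u ^ 2)) * C.x 0 (-1) (t * u ^ 3) *
        C.x 3 1 (2 * t ^ 2 * u ^ 3) ∧
    comm (C.x 3 2 u) (C.x (-1) (-1) t) =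
      C.x 2 1 (t * u) * C.x 1 0 (t ^ 2 * u) * C.x 0 (-1) (-(t ^ 3 * u)) *
        C.x 3 1 (t ^ 3 * u ^ 2) ∧
    comm (C.x (-2) (-1) u) (C.x 3 2 t) =
      C.x 1 1 (t * u) * C.x (-1) 0 (t * u ^ 2) * C.x (-3) (-1) (-(t * u ^ 3)) *
        C.x 0 1 (2 * t ^ 2 * u ^ 3) ∧
    comm (C.x 3 2 u) (C.x (-2) (-1) t) =
      C.x 1 1 (-(t * u)) * C.x (-1) 0 (-(t ^ 2 * u)) *
        C.x (-3) (-1) (t ^ 3 * u) * C.x 0 1 (t ^ 3 * u ^ 2) ∧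
    comm (C.x (-3) (-1) u) (C.x 3 2 t) =
      C.x 0 1 (-(t * u)) := by
  have hC : C.IsExtraspecialPos := ⟨hab, ha_ab, ha_2ab, hb_3ab⟩
  simp only [ChevalleyBasis.x_eq_rootElt]
  refine ⟨?_, ?_, ?_, ?_, ?_, ?_, ?_, ?_, ?_, ?_, ?_, ?_, ?_, ?_, ?_, ?_, ?_, ?_, ?_, ?_, ?_, ?_,
    ?_, ?_, ?_, ?_, ?_, ?_, ?_, ?_, ?_, ?_, ?_, ?_, ?_, ?_, ?_, ?_, ?_, ?_, ?_⟩
  -- In each case the list transcribes the right-hand side: a root, the integer coefficient, and the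
  -- degrees in `t` and in `u`.
  · simpa [Letter.arg, mul_assoc] using hC.comm_rootElt t u (rt 0 1) (rt 1 0)
      [⟨rt 1 1, -1, 1, 1⟩, ⟨rt 2 1, 1, 2, 1⟩, ⟨rt 3 1, -1, 3, 1⟩, ⟨rt 3 2, -1, 3, 2⟩]
      (by decide +kernel)
  · simpa [Letter.arg, mul_assoc] using hC.comm_rootElt t u (rt 1 0) (rt 0 1)
      [⟨rt 1 1, 1, 1, 1⟩, ⟨rt 2 1, -1, 1, 2⟩, ⟨rt 3 1, 1, 1, 3⟩, ⟨rt 3 2, -2, 2, 3⟩]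
      (by decide +kernel)
  · simpa [Letter.arg, mul_assoc] using hC.comm_rootElt t u (rt 1 1) (rt 1 0)
      [⟨rt 2 1, -2, 1, 1⟩, ⟨rt 3 1, 3, 2, 1⟩, ⟨rt 3 2, -3, 1, 2⟩] (by decide +kernel)
  · simpa [Letter.arg, mul_assoc] using hC.comm_rootElt t u (rt 2 1) (rt 1 0)
      [⟨rt 3 1, -3, 1, 1⟩] (by decide +kernel)
  · simpa [Letter.arg, mul_assoc] using hC.comm_rootElt t u (rt 3 1) (rt 0 1)
      [⟨rt 3 2, -1, 1, 1⟩] (by decide +kernel)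
  · simpa [Letter.arg, mul_assoc] using hC.comm_rootElt t u (rt 2 1) (rt 1 1)
      [⟨rt 3 2, 3, 1, 1⟩] (by decide +kernel)
  · simpa [Letter.arg, mul_assoc] using hC.comm_rootElt t u (rt 0 (-1)) (rt (-1) 0)
      [⟨rt (-1) (-1), 1, 1, 1⟩, ⟨rt (-2) (-1), 1, 2, 1⟩,
        ⟨rt (-3) (-1), 1, 3, 1⟩, ⟨rt (-3) (-2), -1, 3, 2⟩] (by decide +kernel)
  · simpa [Letter.arg, mul_assoc] using hC.comm_rootElt t u (rt (-1) 0) (rt 0 (-1))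
      [⟨rt (-1) (-1), -1, 1, 1⟩, ⟨rt (-2) (-1), -1, 1, 2⟩,
        ⟨rt (-3) (-1), -1, 1, 3⟩, ⟨rt (-3) (-2), -2, 2, 3⟩] (by decide +kernel)
  · simpa [Letter.arg, mul_assoc] using hC.comm_rootElt t u (rt (-1) (-1)) (rt (-1) 0)
      [⟨rt (-2) (-1), 2, 1, 1⟩, ⟨rt (-3) (-1), 3, 2, 1⟩, ⟨rt (-3) (-2), -3, 1, 2⟩]
      (by decide +kernel)
  · simpa [Letter.arg, mul_assoc] using hC.comm_rootElt t u (rt (-2) (-1)) (rt (-1) 0)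
      [⟨rt (-3) (-1), 3, 1, 1⟩] (by decide +kernel)
  · simpa [Letter.arg, mul_assoc] using hC.comm_rootElt t u (rt (-3) (-1)) (rt 0 (-1))
      [⟨rt (-3) (-2), 1, 1, 1⟩] (by decide +kernel)
  · simpa [Letter.arg, mul_assoc] using hC.comm_rootElt t u (rt (-2) (-1)) (rt (-1) (-1))
      [⟨rt (-3) (-2), -3, 1, 1⟩] (by decide +kernel)
  · simpa [Letter.arg, mul_assoc] using hC.comm_rootElt t u (rt (-1) (-1)) (rt 1 0)
      [⟨rt 0 (-1), 3, 1, 1⟩] (by decide +kernel)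
  · simpa [Letter.arg, mul_assoc] using hC.comm_rootElt t u (rt (-2) (-1)) (rt 1 0)
      [⟨rt (-1) (-1), 2, 1, 1⟩, ⟨rt 0 (-1), 3, 2, 1⟩, ⟨rt (-3) (-2), 3, 1, 2⟩]
      (by decide +kernel)
  · simpa [Letter.arg, mul_assoc] using hC.comm_rootElt t u (rt (-3) (-1)) (rt 1 0)
      [⟨rt (-2) (-1), 1, 1, 1⟩, ⟨rt (-1) (-1), 1, 2, 1⟩,
        ⟨rt 0 (-1), 1, 3, 1⟩, ⟨rt (-3) (-2), 1, 3, 2⟩] (by decide +kernel)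
  · simpa [Letter.arg, mul_assoc] using hC.comm_rootElt t u (rt 1 0) (rt (-3) (-1))
      [⟨rt (-2) (-1), -1, 1, 1⟩, ⟨rt (-1) (-1), -1, 1, 2⟩,
        ⟨rt 0 (-1), -1, 1, 3⟩, ⟨rt (-3) (-2), 2, 2, 3⟩] (by decide +kernel)
  · simpa [Letter.arg, mul_assoc] using hC.comm_rootElt t u (rt 0 1) (rt (-1) (-1))
      [⟨rt (-1) 0, 1, 1, 1⟩, ⟨rt (-2) (-1), -1, 2, 1⟩,
        ⟨rt (-3) (-2), 1, 3, 1⟩, ⟨rt (-3) (-1), -1, 3, 2⟩] (by decide +kernel)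
  · simpa [Letter.arg, mul_assoc] using hC.comm_rootElt t u (rt (-1) (-1)) (rt 0 1)
      [⟨rt (-1) 0, -1, 1, 1⟩, ⟨rt (-2) (-1), 1, 1, 2⟩,
        ⟨rt (-3) (-2), -1, 1, 3⟩, ⟨rt (-3) (-1), -2, 2, 3⟩] (by decide +kernel)
  · simpa [Letter.arg, mul_assoc] using hC.comm_rootElt t u (rt (-3) (-2)) (rt 0 1)
      [⟨rt (-3) (-1), 1, 1, 1⟩] (by decide +kernel)
  · simpa [Letter.arg, mul_assoc] using hC.comm_rootElt t u (rt (-1) 0) (rt 1 1)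
      [⟨rt 0 1, 3, 1, 1⟩] (by decide +kernel)
  · simpa [Letter.arg, mul_assoc] using hC.comm_rootElt t u (rt 0 (-1)) (rt 1 1)
      [⟨rt 1 0, -1, 1, 1⟩, ⟨rt 2 1, -1, 2, 1⟩, ⟨rt 3 2, -1, 3, 1⟩, ⟨rt 3 1, -1, 3, 2⟩]
      (by decide +kernel)
  · simpa [Letter.arg, mul_assoc] using hC.comm_rootElt t u (rt 1 1) (rt 0 (-1))
      [⟨rt 1 0, 1, 1, 1⟩, ⟨rt 2 1, 1, 1, 2⟩, ⟨rt 3 2, 1, 1, 3⟩, ⟨rt 3 1, -2, 2, 3⟩]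
      (by decide +kernel)
  · simpa [Letter.arg, mul_assoc] using hC.comm_rootElt t u (rt (-2) (-1)) (rt 1 1)
      [⟨rt (-1) 0, -2, 1, 1⟩, ⟨rt 0 1, -3, 2, 1⟩, ⟨rt (-3) (-1), 3, 1, 2⟩] (by decide +kernel)
  · simpa [Letter.arg, mul_assoc] using hC.comm_rootElt t u (rt (-3) (-2)) (rt 1 1)
      [⟨rt (-2) (-1), -1, 1, 1⟩, ⟨rt (-1) 0, 1, 2, 1⟩,
        ⟨rt 0 1, 1, 3, 1⟩, ⟨rt (-3) (-1), 1, 3, 2⟩] (by decide +kernel)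
  · simpa [Letter.arg, mul_assoc] using hC.comm_rootElt t u (rt 1 1) (rt (-3) (-2))
      [⟨rt (-2) (-1), 1, 1, 1⟩, ⟨rt (-1) 0, -1, 1, 2⟩,
        ⟨rt 0 1, -1, 1, 3⟩, ⟨rt (-3) (-1), 2, 2, 3⟩] (by decide +kernel)
  · simpa [Letter.arg, mul_assoc] using hC.comm_rootElt t u (rt (-1) 0) (rt 2 1)
      [⟨rt 1 1, 2, 1, 1⟩, ⟨rt 3 2, -3, 2, 1⟩, ⟨rt 0 1, -3, 1, 2⟩] (by decide +kernel)
  · simpa [Letter.arg, mul_assoc] using hC.comm_rootElt t u (rt (-1) (-1)) (rt 2 1)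
      [⟨rt 1 0, -2, 1, 1⟩, ⟨rt 3 1, -3, 2, 1⟩, ⟨rt 0 (-1), 3, 1, 2⟩] (by decide +kernel)
  · simpa [Letter.arg, mul_assoc] using hC.comm_rootElt t u (rt (-3) (-1)) (rt 2 1)
      [⟨rt (-1) 0, -1, 1, 1⟩, ⟨rt 1 1, -1, 2, 1⟩, ⟨rt 3 2, 1, 3, 1⟩, ⟨rt 0 1, -1, 3, 2⟩]
      (by decide +kernel)
  · simpa [Letter.arg, mul_assoc] using hC.comm_rootElt t u (rt 2 1) (rt (-3) (-1))
      [⟨rt (-1) 0, 1, 1, 1⟩, ⟨rt 1 1, 1, 1, 2⟩, ⟨rt 3 2, -1, 1, 3⟩, ⟨rt 0 1, -2, 2, 3⟩]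
      (by decide +kernel)
  · simpa [Letter.arg, mul_assoc] using hC.comm_rootElt t u (rt (-3) (-2)) (rt 2 1)
      [⟨rt (-1) (-1), 1, 1, 1⟩, ⟨rt 1 0, -1, 2, 1⟩, ⟨rt 3 1, -1, 3, 1⟩, ⟨rt 0 (-1), 1, 3, 2⟩]
      (by decide +kernel)
  · simpa [Letter.arg, mul_assoc] using hC.comm_rootElt t u (rt 2 1) (rt (-3) (-2))
      [⟨rt (-1) (-1), -1, 1, 1⟩, ⟨rt 1 0, 1, 1, 2⟩, ⟨rt 3 1, 1, 1, 3⟩, ⟨rt 0 (-1), 2, 2, 3⟩]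
      (by decide +kernel)
  · simpa [Letter.arg, mul_assoc] using hC.comm_rootElt t u (rt (-1) 0) (rt 3 1)
      [⟨rt 2 1, 1, 1, 1⟩, ⟨rt 1 1, -1, 1, 2⟩, ⟨rt 0 1, 1, 1, 3⟩, ⟨rt 3 2, 2, 2, 3⟩]
      (by decide +kernel)
  · simpa [Letter.arg, mul_assoc] using hC.comm_rootElt t u (rt 3 1) (rt (-1) 0)
      [⟨rt 2 1, -1, 1, 1⟩, ⟨rt 1 1, 1, 2, 1⟩, ⟨rt 0 1, -1, 3, 1⟩, ⟨rt 3 2, 1, 3, 2⟩]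
      (by decide +kernel)
  · simpa [Letter.arg, mul_assoc] using hC.comm_rootElt t u (rt (-2) (-1)) (rt 3 1)
      [⟨rt 1 0, -1, 1, 1⟩, ⟨rt (-1) (-1), 1, 1, 2⟩,
        ⟨rt (-3) (-2), 1, 1, 3⟩, ⟨rt 0 (-1), -2, 2, 3⟩] (by decide +kernel)
  · simpa [Letter.arg, mul_assoc] using hC.comm_rootElt t u (rt 3 1) (rt (-2) (-1))
      [⟨rt 1 0, 1, 1, 1⟩, ⟨rt (-1) (-1), -1, 2, 1⟩,
        ⟨rt (-3) (-2), -1, 3, 1⟩, ⟨rt 0 (-1), -1, 3, 2⟩] (by decide +kernel)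
  · simpa [Letter.arg, mul_assoc] using hC.comm_rootElt t u (rt (-3) (-2)) (rt 3 1)
      [⟨rt 0 (-1), -1, 1, 1⟩] (by decide +kernel)
  · simpa [Letter.arg, mul_assoc] using hC.comm_rootElt t u (rt (-1) (-1)) (rt 3 2)
      [⟨rt 2 1, -1, 1, 1⟩, ⟨rt 1 0, -1, 1, 2⟩, ⟨rt 0 (-1), 1, 1, 3⟩, ⟨rt 3 1, 2, 2, 3⟩]
      (by decide +kernel)
  · simpa [Letter.arg, mul_assoc] using hC.comm_rootElt t u (rt 3 2) (rt (-1) (-1))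
      [⟨rt 2 1, 1, 1, 1⟩, ⟨rt 1 0, 1, 2, 1⟩, ⟨rt 0 (-1), -1, 3, 1⟩, ⟨rt 3 1, 1, 3, 2⟩]
      (by decide +kernel)
  · simpa [Letter.arg, mul_assoc] using hC.comm_rootElt t u (rt (-2) (-1)) (rt 3 2)
      [⟨rt 1 1, 1, 1, 1⟩, ⟨rt (-1) 0, 1, 1, 2⟩, ⟨rt (-3) (-1), -1, 1, 3⟩, ⟨rt 0 1, 2, 2, 3⟩]
      (by decide +kernel)
  · simpa [Letter.arg, mul_assoc] using hC.comm_rootElt t u (rt 3 2) (rt (-2) (-1))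
      [⟨rt 1 1, -1, 1, 1⟩, ⟨rt (-1) 0, -1, 2, 1⟩, ⟨rt (-3) (-1), 1, 3, 1⟩, ⟨rt 0 1, 1, 3, 2⟩]
      (by decide +kernel)
  · simpa [Letter.arg, mul_assoc] using hC.comm_rootElt t u (rt (-3) (-1)) (rt 3 2)
      [⟨rt 0 1, -1, 1, 1⟩] (by decide +kernel)
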